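/- **Setting.** Let $n\ge 2$, let $q\in\mathbb C\setminus\{0\}$ with $|q|\neq 1$, and fix a logarithm $\kappa$ of $q$, so that $q^x:=e^{\kappa x}$ for $x\in\mathbb R$. Put $[x]_q=\frac{q^x-q^{-x}}{q-q^{-1}}$. Let $\mu_1,\dots,\mu_n>0$, $\gamma_i=\mu_i+\frac12$, $\gamma_{[m]}=\gamma_1+\dots+\gamma_m$, where $[m]=\{1,\dots,m\}$. Let $\mathcal P(\mathbb R^n)$ be the space of complex-valued polynomials in $x_1,\dots,x_n$. On it, $r_i$ is the reflection $x_i\mapsto -x_i$, $T_{q,i}^{s}$ is the $q$-shift $x_i\mapsto q^s x_i$, and $$D_i^q=\frac{q^{\mu_i}}{q-q^{-1}}\,\frac{T_{q,i}-r_i}{x_i}-\frac{q^{-\mu_i}}{q-q^{-1}}\,\frac{T_{q,i}^{-1}-r_i}{x_i}.$$ For $1\le k\le m\le n$ let $$R_{[m],k}^q=\prod_{l<k}q^{-\gamma_l/2}T_{q,l}^{-1/2}\prod_{k<l\le m}q^{\gamma_l/2}T_{q,l}^{1/2}r_l\prod_{m<l\le n}r_l,\qquad D_{[m]}^q=\sum_{k=1}^m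 D_k^qR_{[m],k}^q,\qquad X_{[m]}^q=\sum_{k=1}^m x_kR_{[m],k}^q .$$ Let $\mathcal M_k^q(\mathbb R^n)$ be the space of homogeneous polynomials of degree $k$ in the kernel of $D_{[n]}^q$. **The operators $\Gamma_{[\ell]}^q$.** Let $\mathfrak{osp}_q(1|2)$ be the unital associative $\mathbb C$-algebra with generators $A_\pm,K^{\pm1},P$ and relations $KA_\pm K^{-1}=q^{\pm1/2}A_\pm$, $A_+A_-+A_-A_+=\frac{K^2-K^{-2}}{q^{1/2}-q^{-1/2}}$, $PA_\pm=-A_\pm P$, $PK^{\pm1}=K^{\pm1}P$, $KK^{-1}=K^{-1}K=1$, $P^2=1$. Its coproduct is the algebra homomorphism with $\Delta(A_\pm)=A_\pm\otimes KP+K^{-1}\otimes A_\pm$, $\Delta(K^{\pm1})=K^{\pm1}\otimes K^{\pm1}$, $\Delta(P)=P\otimes P$, where $(a_1\otimes a_2)(b_1\otimes b_2)=a_1b_1\otimes a_2b_2$. Let $$\Gamma^q=\Big(-A_+A_-+\frac{q^{-1/2}K^2-q^{1/2}K^{-2}}{q-q^{-1}}\Big)P .$$ For $1\le\ell\le n$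 let $\Gamma_{[\ell]}^q\in\mathfrak{osp}_q(1|2)^{\otimes n}$ be obtained from $\Gamma^q$ by applying $\Delta$ successively $\ell-1$ times, each time to the last tensor factor, and then appending $n-\ell$ tensor factors $1$. Denote by the same symbol the operator on $\mathcal P(\mathbb R^n)$ that realizes this element when the generators in the $i$-th tensor factor act by $A_+\mapsto x_i$, $A_-\mapsto D_i^q$, $K\mapsto q^{\gamma_i/2}T_{q,i}^{1/2}$, $P\mapsto r_i$. **The functions $\psi_{\mathbf j}$.** For $2\le j\le n$ and a homogeneous polynomial $p$ of degree $k$ in $x_1,\dots,x_{j-1}$ let $$\mathbf{CK}_{x_j}^{\mu_j}p=\sum_{\alpha=0}^{k}\frac{(-1)^{\frac{\alpha(\alpha+1)}2}\,q^{\frac\alpha2(\gamma_{[j]}+k-1)}}{[\mu_j,\alpha;q]\,[\mu_j,\alpha-1;q]\cdots[\mu_j,1;q]}\;x_j^\alpha\,(D_{[j-1]}^q)^\alpha p,\qquad [\mu,m;q]=[\mu+m]_q-(-1)^m[\mu]_q .$$ For $\mathbf j=(j_1,\dots,j_{n-1})\in\mathbb N^{n-1}$ (where $0\in\mathbb N$)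 let $|\mathbf j_m|=j_1+\dots+j_m$, with $|\mathbf j_0|=0$, and $$\psi_{\mathbf j}=\mathbf{CK}_{x_n}^{\mu_n}\Big[(X_{[n-1]}^q)^{j_{n-1}}\,\mathbf{CK}_{x_{n-1}}^{\mu_{n-1}}\big[\cdots\big[(X_{[2]}^q)^{j_2}\,\mathbf{CK}_{x_2}^{\mu_2}(x_1^{j_1})\big]\cdots\big]\Big].$$ **Proposition (spherical $q$-Dirac–Dunkl equation).** Let $\mathbf j\in\mathbb N^{n-1}$ and $k=j_1+\dots+j_{n-1}$. Then $\psi_{\mathbf j}$ is a non-zero element of $\mathcal M_k^q(\mathbb R^n)$, and it is a joint eigenfunction of the operators $\Gamma_{[\ell]}^q$: for every $\ell\in\{1,\dots,n\}$, $$\Gamma_{[\ell]}^q\,\psi_{\mathbf j}=(-1)^{|\mathbf j_{\ell-1}|}\Big[\,|\mathbf j_{\ell-1}|+\gamma_{[\ell]}-\tfrac12\Big]_q\,\psi_{\mathbf j}.$$ -/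

import Mathlib

open scoped TensorProduct

namespace QDiracDunkl

noncomputable section

/-! ### `q`-powers and `q`-numbers

The deformation parameter is `q = exp κ`.  Fixing the logarithm `κ` of `q` fixes the
meaning of all real powers of `q`, namely `q ^ x = exp (κ * x)`. -/

/-- The power `q ^ x`, where `q = exp κ`. -/
def qpow (κ : ℂ) (x : ℝ) : ℂ := Complex.exp (κ * (x : ℂ))

/-- The `q`-number `[x]_q = (q ^ x - q ^ (-x)) / (q - q⁻¹)`, where `q = exp κ`. -/
def qnum (κ : ℂ) (x : ℝ) : ℂ := (qpow κ x - qpow κ (-x)) / (qpow κ 1 - qpow κ (-1))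

lemma qpow_add (κ : ℂ) (x y : ℝ) : qpow κ (x + y) = qpow κ x * qpow κ y := by
  simp [qpow, mul_add, Complex.exp_add]

lemma qpow_zero (κ : ℂ) : qpow κ 0 = 1 := by simp [qpow]

lemma qpow_ne_zero (κ : ℂ) (x : ℝ) : qpow κ x ≠ 0 := Complex.exp_ne_zero _

lemma qpow_neg (κ : ℂ) (x : ℝ) : qpow κ (-x) = (qpow κ x)⁻¹ := by
  simp [qpow, Complex.exp_neg]

lemma qpow_half_mul (κ : ℂ) : qpow κ (1 / 2) * qpow κ (1 / 2) = qpow κ 1 := by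
  rw [← qpow_add]; norm_num

/-! ### The quantum superalgebra `osp_q(1|2)` by generators and relations -/

/-- The generators `A₊`, `A₋`, `K`, `K⁻¹`, `P`. -/
inductive Gen : Type
  | Ap
  | Am
  | K
  | Kinv
  | P

/-- The corresponding element of the free algebra. -/
abbrev fr (g : Gen) : FreeAlgebra ℂ Gen := FreeAlgebra.ι ℂ g

/-- The defining relations of `osp_q(1|2)`:
`K A₊ K⁻¹ = q^(1/2) A₊`, `K A₋ K⁻¹ = q^(-1/2) A₋`,
`{A₊, A₋} = (K² - K⁻²) / (q^(1/2) - q^(-1/2))`, `{P, A₊} = {P, A₋} = 0`, `[P, K] = [P, K⁻¹] = 0`,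
`K K⁻¹ = K⁻¹ K = 1`, `P² = 1`. -/
inductive OspRel (κ : ℂ) : FreeAlgebra ℂ Gen → FreeAlgebra ℂ Gen → Prop
  | K_Ap : OspRel κ (fr .K * fr .Ap * fr .Kinv) (qpow κ (1 / 2) • fr .Ap)
  | K_Am : OspRel κ (fr .K * fr .Am * fr .Kinv) (qpow κ (-(1 / 2)) • fr .Am)
  | Ap_Am : OspRel κ (fr .Ap * fr .Am + fr .Am * fr .Ap)
      ((qpow κ (1 / 2) - qpow κ (-(1 / 2)))⁻¹ • (fr .K ^ 2 - fr .Kinv ^ 2))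
  | P_Ap : OspRel κ (fr .P * fr .Ap + fr .Ap * fr .P) 0
  | P_Am : OspRel κ (fr .P * fr .Am + fr .Am * fr .P) 0
  | P_K : OspRel κ (fr .P * fr .K) (fr .K * fr .P)
  | P_Kinv : OspRel κ (fr .P * fr .Kinv) (fr .Kinv * fr .P)
  | K_Kinv : OspRel κ (fr .K * fr .Kinv) 1
  | Kinv_K : OspRel κ (fr .Kinv * fr .K) 1
  | P_P : OspRel κ (fr .P ^ 2) 1

/-- The algebra `osp_q(1|2)`, with `q = exp κ`. -/
def Osp (κ : ℂ) : Type := RingQuot (OspRel κ)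

instance instRingOsp (κ : ℂ) : Ring (Osp κ) := inferInstanceAs (Ring (RingQuot (OspRel κ)))

instance instAlgebraOsp (κ : ℂ) : Algebra ℂ (Osp κ) :=
  inferInstanceAs (Algebra ℂ (RingQuot (OspRel κ)))

/-- The quotient map from the free algebra. -/
def ospMk (κ : ℂ) : FreeAlgebra ℂ Gen →ₐ[ℂ] Osp κ := RingQuot.mkAlgHom ℂ (OspRel κ)

lemma ospMk_rel {κ : ℂ} {x y : FreeAlgebra ℂ Gen} (h : OspRel κ x y) : ospMk κ x = ospMk κ y :=
  RingQuot.mkAlgHom_rel ℂ h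

/-- The generators as elements of `osp_q(1|2)`. -/
def gen (κ : ℂ) (g : Gen) : Osp κ := ospMk κ (fr g)

section Lift

/-- The relations of `osp_q(1|2)` for a family of elements of an algebra. -/
structure IsOspFamily (κ : ℂ) {B : Type} [Ring B] [Algebra ℂ B] (f : Gen → B) : Prop where
  K_Ap : f .K * f .Ap = qpow κ (1 / 2) • (f .Ap * f .K)
  K_Am : f .K * f .Am = qpow κ (-(1 / 2)) • (f .Am * f .K)
  Ap_Am : f .Ap * f .Am + f .Am * f .Ap =
    (qpow κ (1 / 2) - qpow κ (-(1 / 2)))⁻¹ • (f .K ^ 2 - f .Kinv ^ 2)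
  P_Ap : f .P * f .Ap = - (f .Ap * f .P)
  P_Am : f .P * f .Am = - (f .Am * f .P)
  P_K : f .P * f .K = f .K * f .P
  P_Kinv : f .P * f .Kinv = f .Kinv * f .P
  K_Kinv : f .K * f .Kinv = 1
  Kinv_K : f .Kinv * f .K = 1
  P_P : f .P * f .P = 1

/-- A family satisfying the relations gives an algebra homomorphism from `osp_q(1|2)`. -/
def ospLift (κ : ℂ) {B : Type} [Ring B] [Algebra ℂ B] (f : Gen → B) (h : IsOspFamily κ f) :
    Osp κ →ₐ[ℂ] B :=
  RingQuot.liftAlgHom ℂ ⟨FreeAlgebra.lift ℂ f, by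
    intro x y hxy
    cases hxy with
    | K_Ap =>
      simp only [map_mul, map_smul, FreeAlgebra.lift_ι_apply]
      rw [h.K_Ap, smul_mul_assoc, mul_assoc, h.K_Kinv, mul_one]
    | K_Am =>
      simp only [map_mul, map_smul, FreeAlgebra.lift_ι_apply]
      rw [h.K_Am, smul_mul_assoc, mul_assoc, h.K_Kinv, mul_one]
    | Ap_Am => simpa using h.Ap_Am
    | P_Ap => simp [h.P_Ap]
    | P_Am => simp [h.P_Am]
    | P_K => simpa using h.P_K
    | P_Kinv => simpa using h.P_Kinv
    | K_Kinv => simpa using h.K_Kinv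
    | Kinv_K => simpa using h.Kinv_K
    | P_P => simpa [sq] using h.P_P⟩

lemma ospLift_gen (κ : ℂ) {B : Type} [Ring B] [Algebra ℂ B] (f : Gen → B)
    (h : IsOspFamily κ f) (g : Gen) : ospLift κ f h (gen κ g) = f g := by
  exact (RingQuot.liftAlgHom_mkAlgHom_apply ℂ _ _ _).trans (FreeAlgebra.lift_ι_apply _ _)

lemma isOspFamily_gen (κ : ℂ) : IsOspFamily κ (gen κ) where
  K_Ap := by
    have h := ospMk_rel (OspRel.K_Ap (κ := κ))
    have h' := ospMk_rel (OspRel.Kinv_K (κ := κ))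
    simp only [map_mul, map_smul, map_one] at h h'
    have := congrArg (· * gen κ .K) h
    simpa [gen, mul_assoc, h'] using this
  K_Am := by
    have h := ospMk_rel (OspRel.K_Am (κ := κ))
    have h' := ospMk_rel (OspRel.Kinv_K (κ := κ))
    simp only [map_mul, map_smul, map_one] at h h'
    have := congrArg (· * gen κ .K) h
    simpa [gen, mul_assoc, h'] using this
  Ap_Am := by
    simpa [gen] using ospMk_rel (OspRel.Ap_Am (κ := κ))
  P_Ap := by
    have h := ospMk_rel (OspRel.P_Ap (κ := κ))
    simp only [map_mul, map_add, map_zero] at h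
    exact eq_neg_of_add_eq_zero_left h
  P_Am := by
    have h := ospMk_rel (OspRel.P_Am (κ := κ))
    simp only [map_mul, map_add, map_zero] at h
    exact eq_neg_of_add_eq_zero_left h
  P_K := by simpa [gen] using ospMk_rel (OspRel.P_K (κ := κ))
  P_Kinv := by simpa [gen] using ospMk_rel (OspRel.P_Kinv (κ := κ))
  K_Kinv := by simpa [gen] using ospMk_rel (OspRel.K_Kinv (κ := κ))
  Kinv_K := by simpa [gen] using ospMk_rel (OspRel.Kinv_K (κ := κ))
  P_P := by simpa [gen, sq] using ospMk_rel (OspRel.P_P (κ := κ))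

end Lift

/-- The Casimir element
`Γ^q = (-A₊ A₋ + (q^(-1/2) K² - q^(1/2) K⁻²) / (q - q⁻¹)) P` of `osp_q(1|2)`. -/
def casimir (κ : ℂ) : Osp κ :=
  (-(gen κ .Ap * gen κ .Am) + (qpow κ 1 - qpow κ (-1))⁻¹ •
    (qpow κ (-(1 / 2)) • gen κ .K ^ 2 - qpow κ (1 / 2) • gen κ .Kinv ^ 2)) * gen κ .P

/-! ### The coproduct -/

/-- The values of the coproduct on the generators:
`Δ(A±) = A± ⊗ K P + K⁻¹ ⊗ A±`, `Δ(K) = K ⊗ K`, `Δ(K⁻¹) = K⁻¹ ⊗ K⁻¹`, `Δ(P) = P ⊗ P`. -/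
def coprodGen (κ : ℂ) : Gen → Osp κ ⊗[ℂ] Osp κ
  | .Ap => gen κ .Ap ⊗ₜ[ℂ] (gen κ .K * gen κ .P) + gen κ .Kinv ⊗ₜ[ℂ] gen κ .Ap
  | .Am => gen κ .Am ⊗ₜ[ℂ] (gen κ .K * gen κ .P) + gen κ .Kinv ⊗ₜ[ℂ] gen κ .Am
  | .K => gen κ .K ⊗ₜ[ℂ] gen κ .K
  | .Kinv => gen κ .Kinv ⊗ₜ[ℂ] gen κ .Kinv
  | .P => gen κ .P ⊗ₜ[ℂ] gen κ .P

section Coproduct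

lemma IsOspFamily.Kinv_Ap {κ : ℂ} {B : Type} [Ring B] [Algebra ℂ B] {f : Gen → B}
    (h : IsOspFamily κ f) : f .Kinv * f .Ap = qpow κ (-(1 / 2)) • (f .Ap * f .Kinv) := by
  have h1 : f .Kinv * (f .K * f .Ap) * f .Kinv
      = qpow κ (1 / 2) • (f .Kinv * f .Ap * (f .K * f .Kinv)) := by
    rw [h.K_Ap]; simp [mul_assoc]
  rw [h.K_Kinv, ← mul_assoc, h.Kinv_K, one_mul, mul_one] at h1
  rw [h1, smul_smul, ← qpow_add]
  simp [qpow_zero]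

lemma IsOspFamily.Kinv_Am {κ : ℂ} {B : Type} [Ring B] [Algebra ℂ B] {f : Gen → B}
    (h : IsOspFamily κ f) : f .Kinv * f .Am = qpow κ (1 / 2) • (f .Am * f .Kinv) := by
  have h1 : f .Kinv * (f .K * f .Am) * f .Kinv
      = qpow κ (-(1 / 2)) • (f .Kinv * f .Am * (f .K * f .Kinv)) := by
    rw [h.K_Am]; simp [mul_assoc]
  rw [h.K_Kinv, ← mul_assoc, h.Kinv_K, one_mul, mul_one] at h1
  rw [h1, smul_smul, ← qpow_add]
  simp [qpow_zero]

lemma isOspFamily_coprodGen (κ : ℂ) : IsOspFamily κ (coprodGen κ) := by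
  have h := isOspFamily_gen κ
  have hPK : gen κ .P * (gen κ .K * gen κ .P) = gen κ .K := by
    rw [← mul_assoc, h.P_K, mul_assoc, h.P_P, mul_one]
  have hKPP : gen κ .K * gen κ .P * gen κ .P = gen κ .K := by
    rw [mul_assoc, h.P_P, mul_one]
  have hKP2 : gen κ .K * gen κ .P * (gen κ .K * gen κ .P) = gen κ .K ^ 2 := by
    rw [mul_assoc, hPK, sq]
  have hKPAp : gen κ .K * gen κ .P * gen κ .Ap
      = -(qpow κ (1 / 2) • (gen κ .Ap * (gen κ .K * gen κ .P))) := by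
    rw [mul_assoc, h.P_Ap, mul_neg, ← mul_assoc, h.K_Ap, smul_mul_assoc, mul_assoc]
  have hKPAm : gen κ .K * gen κ .P * gen κ .Am
      = -(qpow κ (-(1 / 2)) • (gen κ .Am * (gen κ .K * gen κ .P))) := by
    rw [mul_assoc, h.P_Am, mul_neg, ← mul_assoc, h.K_Am, smul_mul_assoc, mul_assoc]
  have hs : qpow κ (1 / 2) * qpow κ (-(1 / 2)) = 1 := by
    rw [← qpow_add]; simp [qpow_zero]
  refine ⟨?_, ?_, ?_, ?_, ?_, ?_, ?_, ?_, ?_, ?_⟩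
  · simp only [coprodGen, mul_add, add_mul, Algebra.TensorProduct.tmul_mul_tmul, h.K_Ap, h.K_Kinv,
      h.Kinv_K, smul_add, TensorProduct.smul_tmul', TensorProduct.tmul_smul]
    rw [mul_assoc (gen κ .K), h.P_K]
  · simp only [coprodGen, mul_add, add_mul, Algebra.TensorProduct.tmul_mul_tmul, h.K_Am, h.K_Kinv,
      h.Kinv_K, smul_add, TensorProduct.smul_tmul', TensorProduct.tmul_smul]
    rw [mul_assoc (gen κ .K), h.P_K]
  · have e1 : coprodGen κ .Ap * coprodGen κ .Am + coprodGen κ .Am * coprodGen κ .Ap =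
        (gen κ .Ap * gen κ .Am + gen κ .Am * gen κ .Ap) ⊗ₜ[ℂ] (gen κ .K ^ 2) +
        (gen κ .Kinv ^ 2) ⊗ₜ[ℂ] (gen κ .Ap * gen κ .Am + gen κ .Am * gen κ .Ap) := by
      simp only [coprodGen, mul_add, add_mul, Algebra.TensorProduct.tmul_mul_tmul, hKP2, hKPAp,
        hKPAm, h.Kinv_Ap, h.Kinv_Am, TensorProduct.tmul_neg, TensorProduct.tmul_smul,
        ← TensorProduct.smul_tmul', TensorProduct.tmul_add, TensorProduct.add_tmul, ← sq]
      abel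
    rw [e1, h.Ap_Am]
    simp only [coprodGen, ← TensorProduct.smul_tmul', TensorProduct.tmul_smul, ← smul_add,
      TensorProduct.tmul_sub, TensorProduct.sub_tmul, sq, Algebra.TensorProduct.tmul_mul_tmul]
    congr 1
    abel
  · simp only [coprodGen, mul_add, add_mul, Algebra.TensorProduct.tmul_mul_tmul, h.P_Ap,
      h.P_Kinv, hPK, hKPP, TensorProduct.neg_tmul, TensorProduct.tmul_neg]
    abel
  · simp only [coprodGen, mul_add, add_mul, Algebra.TensorProduct.tmul_mul_tmul, h.P_Am,
      h.P_Kinv, hPK, hKPP, TensorProduct.neg_tmul, TensorProduct.tmul_neg]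
    abel
  · simp only [coprodGen, Algebra.TensorProduct.tmul_mul_tmul, h.P_K]
  · simp only [coprodGen, Algebra.TensorProduct.tmul_mul_tmul, h.P_Kinv]
  · simp only [coprodGen, Algebra.TensorProduct.tmul_mul_tmul, h.K_Kinv,
      Algebra.TensorProduct.one_def]
  · simp only [coprodGen, Algebra.TensorProduct.tmul_mul_tmul, h.Kinv_K,
      Algebra.TensorProduct.one_def]
  · simp only [coprodGen, Algebra.TensorProduct.tmul_mul_tmul, h.P_P,
      Algebra.TensorProduct.one_def]

end Coproduct

/-- The coproduct `Δ : osp_q(1|2) → osp_q(1|2) ⊗ osp_q(1|2)`, an algebra homomorphism for the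
product `(a₁ ⊗ a₂)(b₁ ⊗ b₂) = a₁ b₁ ⊗ a₂ b₂`. -/
def coprod (κ : ℂ) : Osp κ →ₐ[ℂ] Osp κ ⊗[ℂ] Osp κ :=
  ospLift κ (coprodGen κ) (isOspFamily_coprodGen κ)

/-! ### Tensor powers and the extension procedure -/

/-- The `n`-fold tensor product of `osp_q(1|2)`. -/
abbrev OspPow (κ : ℂ) (n : ℕ) : Type := PiTensorProduct ℂ (fun _ : Fin n => Osp κ)

/-- The identification of `osp_q(1|2)^{⊗ k} ⊗ osp_q(1|2)` with `osp_q(1|2)^{⊗ (k + 1)}`,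
`(a₁ ⊗ ⋯ ⊗ a_k) ⊗ b ↦ a₁ ⊗ ⋯ ⊗ a_k ⊗ b`. -/
def snocEquiv (κ : ℂ) (k : ℕ) : OspPow κ k ⊗[ℂ] Osp κ ≃ₗ[ℂ] OspPow κ (k + 1) :=
  (TensorProduct.congr (LinearEquiv.refl ℂ (OspPow κ k))
    (PiTensorProduct.subsingletonEquiv (R := ℂ) (s := fun _ : Fin 1 => Osp κ) 0).symm).trans
    (TensorPower.mulEquiv (R := ℂ) (M := Osp κ) (n := k) (m := 1))

lemma snocEquiv_tmul (κ : ℂ) (k : ℕ) (a : Fin k → Osp κ) (b : Osp κ) :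
    snocEquiv κ k (PiTensorProduct.tprod ℂ a ⊗ₜ[ℂ] b)
      = PiTensorProduct.tprod ℂ (Fin.snoc a b : Fin (k + 1) → Osp κ) := by
  have h1 : (PiTensorProduct.subsingletonEquiv (R := ℂ) (s := fun _ : Fin 1 => Osp κ) 0).symm b
      = PiTensorProduct.tprod ℂ (fun _ : Fin 1 => b) := by
    rw [LinearEquiv.symm_apply_eq, PiTensorProduct.subsingletonEquiv_apply_tprod]
  have h2 := TensorPower.tprod_mul_tprod (R := ℂ) a (fun _ : Fin 1 => b)
  rw [TensorPower.gMul_def] at h2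
  rw [snocEquiv, LinearEquiv.trans_apply, TensorProduct.congr_tmul, h1, LinearEquiv.refl_apply, h2,
    Fin.append_right_eq_snoc]

/-- The map `1 ⊗ ⋯ ⊗ 1 ⊗ Δ` from `osp_q(1|2)^{⊗ (k + 1)}` to `osp_q(1|2)^{⊗ (k + 2)}`, applying
the coproduct to the last tensor factor. -/
def lastCoprod (κ : ℂ) (k : ℕ) : OspPow κ (k + 1) →ₗ[ℂ] OspPow κ (k + 2) :=
  (snocEquiv κ (k + 1)).toLinearMap ∘ₗ
    TensorProduct.map (snocEquiv κ k).toLinearMap LinearMap.id ∘ₗ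
    (TensorProduct.assoc ℂ (OspPow κ k) (Osp κ) (Osp κ)).symm.toLinearMap ∘ₗ
    TensorProduct.map LinearMap.id (coprod κ).toLinearMap ∘ₗ
    (snocEquiv κ k).symm.toLinearMap

/-- The element `(1 ⊗ ⋯ ⊗ 1 ⊗ Δ) ⋯ (1 ⊗ Δ) Δ (Γ^q)` of `osp_q(1|2)^{⊗ (k + 1)}`, in which the
coproduct is applied `k` times. -/
def iterCasimir (κ : ℂ) : (k : ℕ) → OspPow κ (k + 1)
  | 0 => PiTensorProduct.tprod ℂ (fun _ : Fin 1 => casimir κ)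
  | k + 1 => lastCoprod κ k (iterCasimir κ k)

/-- The element `Γ_{[ℓ]}^q` of `osp_q(1|2)^{⊗ n}`, for `[ℓ] = {1, …, ℓ}` and `ℓ ≤ n`:
the coproduct is applied `ℓ - 1` times to `Γ^q`, each time to the last tensor factor, and the
remaining `n - ℓ` tensor factors are equal to `1`.  For `ℓ = 0` this is the
scalar `Γ_∅^q = -[1/2]_q`. (For `ℓ > n`, which is not used, it is `Γ_{[n]}^q`.) -/
def casimirPow (κ : ℂ) : (n : ℕ) → (ℓ : ℕ) → OspPow κ n
  | 0, _ => -(qnum κ (1 / 2)) • PiTensorProduct.tprod ℂ (fun _ : Fin 0 => (1 : Osp κ))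
  | n + 1, ℓ =>
    if ℓ ≤ n then snocEquiv κ n (casimirPow κ n ℓ ⊗ₜ[ℂ] (1 : Osp κ)) else iterCasimir κ n

/-! ### Operators on polynomials -/

/-- Complex-valued polynomials in `n` real variables. -/
abbrev Poly (n : ℕ) : Type := MvPolynomial (Fin n) ℂ

/-- Linear operators on polynomials. -/
abbrev Op (n : ℕ) : Type := Module.End ℂ (Poly n)

/-- Multiplication by the variable `x_i`. -/
def mulX {n : ℕ} (i : Fin n) : Op n := LinearMap.mulLeft ℂ (MvPolynomial.X i)

/-- The operator sending `f(x_1, …, x_n)` to `f(x_1, …, c x_i, …, x_n)`. -/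
def dilate {n : ℕ} (i : Fin n) (c : ℂ) : Op n :=
  (MvPolynomial.aeval
    (fun j : Fin n => if j = i then c • MvPolynomial.X j else (MvPolynomial.X j : Poly n))
    : Poly n →ₐ[ℂ] Poly n).toLinearMap

/-- The power `T_{q,i} ^ s` of the `q`-shift operator, `x_i ↦ q ^ s x_i`. -/
def qshift {n : ℕ} (κ : ℂ) (i : Fin n) (s : ℝ) : Op n := dilate i (qpow κ s)

/-- The reflection `r_i`, `x_i ↦ -x_i`. -/
def reflOp {n : ℕ} (i : Fin n) : Op n := dilate i (-1)

/-- Division by the variable `x_i`: the linear operator that sends `x_i * f` to `f` and the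
monomials without `x_i` to `0`. It is only used on multiples of `x_i`. -/
def divX {n : ℕ} (i : Fin n) : Op n where
  toFun f := f.divMonomial (Finsupp.single i 1)
  map_add' f g := MvPolynomial.add_divMonomial f g _
  map_smul' c f := by
    ext m
    simp [MvPolynomial.coeff_divMonomial]

/-- The `q`-Dunkl operator
`D_i^q = q^{μ_i}/(q - q⁻¹) (T_{q,i} - r_i)/x_i - q^{-μ_i}/(q - q⁻¹) (T_{q,i}⁻¹ - r_i)/x_i`. -/
def dunkl {n : ℕ} (κ : ℂ) (μ : Fin n → ℝ) (i : Fin n) : Op n :=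
  (qpow κ (μ i) / (qpow κ 1 - qpow κ (-1))) • (divX i * (qshift κ i 1 - reflOp i)) -
  (qpow κ (-μ i) / (qpow κ 1 - qpow κ (-1))) • (divX i * (qshift κ i (-1) - reflOp i))

/-- The parameter `γ_i = μ_i + 1/2`. -/
def gam {n : ℕ} (μ : Fin n → ℝ) (i : Fin n) : ℝ := μ i + 1 / 2

/-- The sum `γ_{[m]} = γ_1 + ⋯ + γ_m`. -/
def gamSum {n : ℕ} (μ : Fin n → ℝ) (m : ℕ) : ℝ :=
  ∑ i : Fin n, if i.val < m then gam μ i else 0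

/-- The operator `q^{γ_i/2} T_{q,i}^{1/2}`, by which `K` acts on the variable `x_i`. -/
def opK {n : ℕ} (κ : ℂ) (μ : Fin n → ℝ) (i : Fin n) : Op n :=
  qpow κ (gam μ i / 2) • qshift κ i (1 / 2)

/-- The inverse operator `q^{-γ_i/2} T_{q,i}^{-1/2}`. -/
def opKinv {n : ℕ} (κ : ℂ) (μ : Fin n → ℝ) (i : Fin n) : Op n :=
  qpow κ (-(gam μ i / 2)) • qshift κ i (-(1 / 2))

/-- The realization of the generators in the variable `x_i`:
`A₊ ↦ x_i`, `A₋ ↦ D_i^q`, `K ↦ q^{γ_i/2} T_{q,i}^{1/2}`, `P ↦ r_i`. -/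
def realGen {n : ℕ} (κ : ℂ) (μ : Fin n → ℝ) (i : Fin n) : Gen → Op n
  | .Ap => mulX i
  | .Am => dunkl κ μ i
  | .K => opK κ μ i
  | .Kinv => opKinv κ μ i
  | .P => reflOp i

section Realization

lemma op_ext {n : ℕ} {S T : Op n}
    (h : ∀ m a, S (MvPolynomial.monomial m a) = T (MvPolynomial.monomial m a)) : S = T := by
  refine LinearMap.ext fun f => ?_
  induction f using MvPolynomial.induction_on' with
  | monomial m a => exact h m a
  | add f g h1 h2 => rw [map_add, map_add, h1, h2]

lemma mulX_monomial {n : ℕ} (i : Fin n) (m : Fin n →₀ ℕ) (a : ℂ) :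
    mulX i (MvPolynomial.monomial m a) = MvPolynomial.monomial (m + Finsupp.single i 1) a := by
  simp [mulX, MvPolynomial.X, MvPolynomial.monomial_mul, add_comm]

lemma dilate_monomial {n : ℕ} (i : Fin n) (c : ℂ) (m : Fin n →₀ ℕ) (a : ℂ) :
    dilate i c (MvPolynomial.monomial m a) = c ^ m i • MvPolynomial.monomial m a := by
  have h : ∀ l : Fin n,
      (if l = i then c • MvPolynomial.X l else (MvPolynomial.X l : Poly n)) ^ m l
        = (if l = i then MvPolynomial.C (c ^ m i) else 1) * MvPolynomial.X l ^ m l := by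
    intro l
    split_ifs with hl
    · subst hl
      rw [MvPolynomial.smul_eq_C_mul, mul_pow, ← map_pow]
    · rw [one_mul]
  rw [dilate, AlgHom.toLinearMap_apply, MvPolynomial.aeval_monomial,
    Finsupp.prod_fintype _ _ (fun _ => pow_zero _)]
  simp only [h, Finset.prod_mul_distrib, Finset.prod_ite_eq', Finset.mem_univ, if_true]
  rw [MvPolynomial.smul_eq_C_mul, MvPolynomial.monomial_eq (s := m),
    Finsupp.prod_fintype _ _ (fun _ => pow_zero _), MvPolynomial.algebraMap_eq]
  ring

lemma divX_mulX {n : ℕ} (i : Fin n) (f : Poly n) : divX i (mulX i f) = f := by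
  exact MvPolynomial.X_mul_divMonomial i f

lemma divX_monomial_add {n : ℕ} (i : Fin n) (m : Fin n →₀ ℕ) (a : ℂ) :
    divX i (MvPolynomial.monomial (m + Finsupp.single i 1) a) = MvPolynomial.monomial m a := by
  rw [← mulX_monomial, divX_mulX]

lemma dunkl_monomial_add {n : ℕ} (κ : ℂ) (μ : Fin n → ℝ) (i : Fin n) (m : Fin n →₀ ℕ) (a : ℂ) :
    dunkl κ μ i (MvPolynomial.monomial (m + Finsupp.single i 1) a) =
      ((qpow κ (μ i) / (qpow κ 1 - qpow κ (-1))) * (qpow κ 1 ^ (m i + 1) - (-1) ^ (m i + 1)) -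
      (qpow κ (-μ i) / (qpow κ 1 - qpow κ (-1))) *
        (qpow κ (-1) ^ (m i + 1) - (-1) ^ (m i + 1))) • MvPolynomial.monomial m a := by
  simp only [dunkl, qshift, reflOp, LinearMap.sub_apply, LinearMap.smul_apply, Module.End.mul_apply,
    dilate_monomial, ← sub_smul, map_smul, divX_monomial_add, smul_smul, Finsupp.add_apply,
    Finsupp.single_eq_same]

lemma dunkl_monomial_zero {n : ℕ} (κ : ℂ) (μ : Fin n → ℝ) (i : Fin n) (m : Fin n →₀ ℕ)
    (hm : m i = 0) (a : ℂ) : dunkl κ μ i (MvPolynomial.monomial m a) = 0 := by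
  simp [dunkl, qshift, reflOp, dilate_monomial, hm]

/-- The division by `x_i` in the `q`-Dunkl operator is exact. -/
lemma mulX_dunkl {n : ℕ} (κ : ℂ) (μ : Fin n → ℝ) (i : Fin n) :
    mulX i * dunkl κ μ i =
      (qpow κ (μ i) / (qpow κ 1 - qpow κ (-1))) • (qshift κ i 1 - reflOp i) -
      (qpow κ (-μ i) / (qpow κ 1 - qpow κ (-1))) • (qshift κ i (-1) - reflOp i) := by
  refine op_ext fun m a => ?_
  rcases Nat.eq_zero_or_pos (m i) with hm | hm
  · simp [dunkl_monomial_zero κ μ i m hm, qshift, reflOp, dilate_monomial, hm]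
  · obtain ⟨m', rfl⟩ : ∃ m', m = m' + Finsupp.single i 1 :=
      ⟨m - Finsupp.single i 1, (tsub_add_cancel_of_le (Finsupp.single_le_iff.mpr hm)).symm⟩
    simp only [Module.End.mul_apply, dunkl_monomial_add, map_smul,
      mulX_monomial, LinearMap.sub_apply, LinearMap.smul_apply, qshift, reflOp, dilate_monomial,
      Finsupp.add_apply, Finsupp.single_eq_same, ← sub_smul, smul_smul]

lemma isOspFamily_realGen {n : ℕ} (κ : ℂ) (hq : ‖Complex.exp κ‖ ≠ 1) (μ : Fin n → ℝ)
    (i : Fin n) : IsOspFamily κ (realGen κ μ i) := by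
  have hK : ∀ m a, opK κ μ i (MvPolynomial.monomial m a) =
      (qpow κ (gam μ i / 2) * qpow κ (1 / 2) ^ m i) • MvPolynomial.monomial m a := by
    intro m a
    simp only [opK, qshift, LinearMap.smul_apply, dilate_monomial, smul_smul]
  have hKi : ∀ m a, opKinv κ μ i (MvPolynomial.monomial m a) =
      (qpow κ (-(gam μ i / 2)) * qpow κ (-(1 / 2)) ^ m i) • MvPolynomial.monomial m a := by
    intro m a
    simp only [opKinv, qshift, LinearMap.smul_apply, dilate_monomial, smul_smul]
  have hr : ∀ m a, reflOp i (MvPolynomial.monomial m a) =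
      ((-1 : ℂ) ^ m i) • MvPolynomial.monomial m a := fun m a => dilate_monomial _ _ _ _
  have hs0 : qpow κ (1 / 2) ≠ 0 := qpow_ne_zero _ _
  have hg0 : qpow κ (gam μ i / 2) ≠ 0 := qpow_ne_zero _ _
  have hq2 : qpow κ 1 ^ 2 ≠ 1 := by
    intro h
    apply hq
    have h1 : ‖qpow κ 1‖ ^ 2 = 1 := by rw [← norm_pow, h, norm_one]
    have h2 : ‖qpow κ 1‖ = 1 := by
      nlinarith [norm_nonneg (qpow κ 1)]
    simpa [qpow] using h2
  have hs4 : qpow κ (1 / 2) ^ 4 ≠ 1 := by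
    rw [show (4 : ℕ) = 2 * 2 from rfl, pow_mul, sq (qpow κ (1 / 2)), qpow_half_mul]
    exact hq2
  have hg : qpow κ (gam μ i / 2) ^ 2 = qpow κ (μ i) * qpow κ (1 / 2) := by
    rw [sq, ← qpow_add, ← qpow_add]; congr 1; simp only [gam]; ring
  have hne : qpow κ (-(1 / 2)) = (qpow κ (1 / 2))⁻¹ := qpow_neg _ _
  have hgne : qpow κ (-(gam μ i / 2)) = (qpow κ (gam μ i / 2))⁻¹ := qpow_neg _ _
  have hq1 : qpow κ 1 = qpow κ (1 / 2) ^ 2 := by rw [sq, qpow_half_mul]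
  have hqn1 : qpow κ (-1) = (qpow κ (1 / 2) ^ 2)⁻¹ := by rw [qpow_neg, hq1]
  have hμg : qpow κ (μ i) = qpow κ (gam μ i / 2) ^ 2 / qpow κ (1 / 2) := by
    rw [hg]; field_simp
  have hμn : qpow κ (-μ i) = (qpow κ (gam μ i / 2) ^ 2 / qpow κ (1 / 2))⁻¹ := by
    rw [qpow_neg, hμg]
  have hcase : ∀ m : Fin n →₀ ℕ, m i = 0 ∨ ∃ m', m = m' + Finsupp.single i 1 := by
    intro m
    rcases Nat.eq_zero_or_pos (m i) with hm | hm
    · exact Or.inl hm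
    · exact Or.inr
        ⟨m - Finsupp.single i 1, (tsub_add_cancel_of_le (Finsupp.single_le_iff.mpr hm)).symm⟩
  generalize hsd : qpow κ (1 / 2) = s at *
  generalize hgd : qpow κ (gam μ i / 2) = g at *
  have hs1 : s ^ 2 - 1 ≠ 0 := by
    intro h
    apply hs4
    linear_combination (s ^ 2 + 1) * h
  have hs2 : s ^ 2 + 1 ≠ 0 := by
    intro h
    apply hs4
    linear_combination (s ^ 2 - 1) * h
  refine ⟨?_, ?_, ?_, ?_, ?_, ?_, ?_, ?_, ?_, ?_⟩ <;>
    refine op_ext fun m a => ?_ <;>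
    simp only [realGen, Module.End.mul_apply, LinearMap.smul_apply,
      LinearMap.add_apply, LinearMap.sub_apply, LinearMap.neg_apply, sq, Module.End.one_apply]
  · simp only [hK, mulX_monomial, map_smul, Finsupp.add_apply, Finsupp.single_eq_same, smul_smul,
      hsd]
    congr 1; ring
  · rcases hcase m with hm | ⟨m, rfl⟩
    · simp only [hK, map_smul, dunkl_monomial_zero κ μ i m hm, map_zero, smul_zero]
    · simp only [hK, dunkl_monomial_add, map_smul, Finsupp.add_apply, Finsupp.single_eq_same,
        smul_smul, hne]
      congr 1
      have hc : ∀ c : ℂ, c * (g * s ^ m i) = s⁻¹ * (g * s ^ (m i + 1) * c) := by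
        intro c
        rw [pow_succ]
        field_simp
      exact hc _
  · rcases hcase m with hm | ⟨m, rfl⟩
    · simp only [hK, hKi, mulX_monomial, map_smul, dunkl_monomial_zero κ μ i m hm, map_zero,
        dunkl_monomial_add, smul_smul, hm, ← sub_smul, zero_add, hne, hgne, hsd, hq1, hqn1, hμg, hμn]
      congr 1; field_simp; ring
    · simp only [hK, hKi, mulX_monomial, map_smul, dunkl_monomial_add, smul_smul, ← sub_smul,
        ← add_smul, hne, hgne, hsd, hq1, hqn1, hμg, hμn, Finsupp.add_apply, Finsupp.single_eq_same,
        pow_succ _ (m i), pow_succ _ (m i + 1), inv_pow, pow_right_comm s 2 (m i)]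
      have ht0 : s ^ m i ≠ 0 := pow_ne_zero _ hs0
      generalize s ^ m i = t at *
      generalize (-1 : ℂ) ^ m i = e at *
      congr 1; field_simp; ring
  · simp only [hr, mulX_monomial, map_smul, Finsupp.add_apply, Finsupp.single_eq_same, pow_succ]
    rw [← neg_smul]; congr 1; ring
  · rcases hcase m with hm | ⟨m, rfl⟩
    · simp only [hr, map_smul, dunkl_monomial_zero κ μ i m hm, map_zero, smul_zero, neg_zero]
    · simp only [hr, dunkl_monomial_add, map_smul, Finsupp.add_apply, Finsupp.single_eq_same,
        smul_smul]
      rw [← neg_smul]; congr 1; ring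
  · simp only [hr, hK, map_smul, smul_smul, mul_comm]
  · simp only [hr, hKi, map_smul, smul_smul, mul_comm]
  · simp only [hK, hKi, map_smul, smul_smul, hne, hgne]
    rw [show g⁻¹ * s⁻¹ ^ m i * (g * s ^ m i) = 1 by rw [inv_pow]; field_simp, one_smul]
  · simp only [hK, hKi, map_smul, smul_smul, hne, hgne]
    rw [show g * s ^ m i * (g⁻¹ * s⁻¹ ^ m i) = 1 by rw [inv_pow]; field_simp, one_smul]
  · simp only [hr, map_smul, smul_smul]
    rw [← mul_pow]; simp

end Realization

/-- The realization of `osp_q(1|2)` by operators in the variable `x_i`. -/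
def realVar {n : ℕ} (κ : ℂ) (hq : ‖Complex.exp κ‖ ≠ 1) (μ : Fin n → ℝ) (i : Fin n) :
    Osp κ →ₐ[ℂ] Op n :=
  ospLift κ (realGen κ μ i) (isOspFamily_realGen κ hq μ i)

/-- The realization of `osp_q(1|2)^{⊗ n}` on polynomials in `n` variables, the `i`-th tensor
factor acting on the variable `x_i`: the linear map sending `a₁ ⊗ ⋯ ⊗ a_n` to the product of
the operators realizing `a₁, …, a_n` in the variables `x_1, …, x_n`. -/
def realize {n : ℕ} (κ : ℂ) (hq : ‖Complex.exp κ‖ ≠ 1) (μ : Fin n → ℝ) :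
    OspPow κ n →ₗ[ℂ] Op n :=
  PiTensorProduct.lift ((MultilinearMap.mkPiAlgebraFin ℂ n (Op n)).compLinearMap
    (fun i => (realVar κ hq μ i).toLinearMap))

/-- The spherical `q`-Dirac-Dunkl operator `Γ_{[ℓ]}^q` on polynomials in `n` variables. -/
def sphericalGamma {n : ℕ} (κ : ℂ) (hq : ‖Complex.exp κ‖ ≠ 1) (μ : Fin n → ℝ) (ℓ : ℕ) : Op n :=
  realize κ hq μ (casimirPow κ n ℓ)

/-! ### `q`-Dirac-Dunkl operators, `q`-Dunkl monogenics, and the basis functions -/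

/-- The operator `R_{[m],k}^q = (∏_{l<k} q^{-γ_l/2} T_{q,l}^{-1/2})
(∏_{k<l≤m} q^{γ_l/2} T_{q,l}^{1/2} r_l) (∏_{m<l≤n} r_l)`. The 0-based index `l : Fin n` stands
for the variable with number `l + 1`. -/
def opR {n : ℕ} (κ : ℂ) (μ : Fin n → ℝ) (m : ℕ) (k : Fin n) : Op n :=
  (List.ofFn fun l : Fin n =>
    if l < k then opKinv κ μ l
    else if l = k then 1
    else if l.val < m then opK κ μ l * reflOp l
    else reflOp l).prod

/-- The `q`-Dirac-Dunkl operator `D_{[m]}^q = ∑_{k ∈ [m]} D_k^q R_{[m],k}^q`. -/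
def opD {n : ℕ} (κ : ℂ) (μ : Fin n → ℝ) (m : ℕ) : Op n :=
  ∑ k : Fin n, if k.val < m then dunkl κ μ k * opR κ μ m k else 0

/-- The position operator `X_{[m]}^q = ∑_{k ∈ [m]} x_k R_{[m],k}^q`. -/
def opX {n : ℕ} (κ : ℂ) (μ : Fin n → ℝ) (m : ℕ) : Op n :=
  ∑ k : Fin n, if k.val < m then mulX k * opR κ μ m k else 0

/-- The space `M_k^q(ℝⁿ)` of `q`-Dunkl monogenics: homogeneous polynomials of degree `k` in the
kernel of `D_{[n]}^q`. -/
def monogenics {n : ℕ} (κ : ℂ) (μ : Fin n → ℝ) (k : ℕ) : Submodule ℂ (Poly n) :=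
  LinearMap.ker (opD κ μ n) ⊓ MvPolynomial.homogeneousSubmodule (Fin n) ℂ k

/-- The symbol `[μ, m; q] = [μ + m]_q - (-1)^m [μ]_q`. -/
def qbracket (κ : ℂ) (μ : ℝ) (m : ℕ) : ℂ := qnum κ (μ + m) - (-1) ^ m * qnum κ μ

/-- The `CK`-extension in the variable with number `j = i + 1`, on homogeneous polynomials of
degree `k` in the variables `x_1, …, x_{j-1}`:
`∑_{α=0}^k (-1)^{α(α+1)/2} q^{(α/2)(γ_{[j]} + k - 1)} / ([μ_j,α;q] ⋯ [μ_j,1;q])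
x_j^α (D_{[j-1]}^q)^α`. -/
def CK {n : ℕ} (κ : ℂ) (μ : Fin n → ℝ) (i : Fin n) (k : ℕ) : Op n :=
  ∑ α ∈ Finset.range (k + 1),
    ((-1) ^ (α * (α + 1) / 2) *
        qpow κ ((α : ℝ) / 2 * (gamSum μ (i.val + 1) + (k : ℝ) - 1)) /
      ∏ s ∈ Finset.Icc 1 α, qbracket κ (μ i) s) •
    (mulX i ^ α * opD κ μ i.val ^ α)

/-- The partial sum `|𝐣_ℓ| = j_1 + ⋯ + j_ℓ` of `𝐣 = (j_1, …, j_{n-1})`. -/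
def partialSum {n : ℕ} (j : Fin (n - 1) → ℕ) (ℓ : ℕ) : ℕ :=
  ∑ i : Fin (n - 1), if i.val < ℓ then j i else 0

/-- The successive stages
`CK_{x_{m+2}}[(X_{[m+1]}^q)^{j_{m+1}} CK_{x_{m+1}}[⋯ (X_{[2]}^q)^{j_2} CK_{x_2}(x_1^{j_1}) ⋯ ]]`
of the construction of the basis functions. The polynomial to which `CK_{x_{m+2}}` is applied
is homogeneous of degree `j_1 + ⋯ + j_{m+1}`. -/
def tower {n : ℕ} (κ : ℂ) (μ : Fin n → ℝ) (j : Fin (n - 1) → ℕ) : (m : ℕ) → m + 2 ≤ n → Poly n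
  | 0, h =>
    CK κ μ ⟨1, by omega⟩ (partialSum j 1) (MvPolynomial.X ⟨0, by omega⟩ ^ j ⟨0, by omega⟩)
  | m + 1, h =>
    CK κ μ ⟨m + 2, by omega⟩ (partialSum j (m + 2))
      ((opX κ μ (m + 2) ^ j ⟨m + 1, by omega⟩) (tower κ μ j m (by omega)))

/-- The basis function `ψ_𝐣` for `𝐣 = (j_1, …, j_{n-1})`, `n ≥ 2`. -/
def psi {n : ℕ} (hn : 2 ≤ n) (κ : ℂ) (μ : Fin n → ℝ) (j : Fin (n - 1) → ℕ) : Poly n :=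
  tower κ μ j (n - 2) (by omega)

/-- The eigenvalue `λ_ℓ(𝐣) = (-1)^{|𝐣_{ℓ-1}|} [|𝐣_{ℓ-1}| + γ_{[ℓ]} - 1/2]_q`, `ℓ ≥ 1`. -/
def eigval {n : ℕ} (κ : ℂ) (μ : Fin n → ℝ) (j : Fin (n - 1) → ℕ) (ℓ : ℕ) : ℂ :=
  (-1) ^ partialSum j (ℓ - 1) *
    qnum κ ((partialSum j (ℓ - 1) : ℝ) + gamSum μ ℓ - 1 / 2)

end

end QDiracDunkl

namespace QDiracDunkl

noncomputable section

/-! ### Homomorphisms out of `osp_q(1|2)` -/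

lemma adjoin_range_gen (κ : ℂ) : Algebra.adjoin ℂ (Set.range (gen κ)) = ⊤ := by
  have h1 : Set.range (gen κ) = ospMk κ '' Set.range (FreeAlgebra.ι ℂ) := by
    rw [← Set.range_comp]; rfl
  rw [h1, ← AlgHom.map_adjoin, FreeAlgebra.adjoin_range_ι, Algebra.map_top,
    AlgHom.range_eq_top]
  exact RingQuot.mkAlgHom_surjective ℂ (OspRel κ)

lemma mem_of_gen_mem {κ : ℂ} {S : Subalgebra ℂ (Osp κ)} (h : ∀ g, gen κ g ∈ S) (a : Osp κ) :
    a ∈ S := by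
  have h1 : Algebra.adjoin ℂ (Set.range (gen κ)) ≤ S :=
    Algebra.adjoin_le (Set.range_subset_iff.mpr h)
  rw [adjoin_range_gen] at h1
  exact h1 Algebra.mem_top

section Hom

variable {κ : ℂ} {B : Type} [Ring B] [Algebra ℂ B]

lemma osp_hom_ext {f g : Osp κ →ₐ[ℂ] B} (h : ∀ x, f (gen κ x) = g (gen κ x)) : f = g :=
  AlgHom.ext fun a => mem_of_gen_mem (S := AlgHom.equalizer f g) h a

lemma osp_hom_commute {f : Osp κ →ₐ[ℂ] B} {b : B} (h : ∀ x, Commute b (f (gen κ x)))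
    (a : Osp κ) : Commute b (f a) :=
  ((Subalgebra.mem_centralizer_iff ℂ).mp
    (mem_of_gen_mem (S := (Subalgebra.centralizer ℂ {b}).comap f)
      (fun x => (Subalgebra.mem_centralizer_iff ℂ).mpr (by rintro _ rfl; exact h x)) a)) b rfl

lemma osp_hom_commute_hom {f g : Osp κ →ₐ[ℂ] B}
    (h : ∀ x y, Commute (f (gen κ x)) (g (gen κ y))) (a b : Osp κ) : Commute (f a) (g b) :=
  osp_hom_commute (fun y => (osp_hom_commute (fun x => (h x y).symm) a).symm) b

lemma IsOspFamily.map {C : Type} [Ring C] [Algebra ℂ C] {f : Gen → B} (h : IsOspFamily κ f)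
    (φ : B →ₐ[ℂ] C) : IsOspFamily κ (fun g => φ (f g)) where
  K_Ap := by rw [← map_mul, h.K_Ap, map_smul, map_mul]
  K_Am := by rw [← map_mul, h.K_Am, map_smul, map_mul]
  Ap_Am := by
    rw [← map_mul, ← map_mul, ← map_add, h.Ap_Am, map_smul, map_sub, map_pow, map_pow]
  P_Ap := by rw [← map_mul, h.P_Ap, map_neg, map_mul]
  P_Am := by rw [← map_mul, h.P_Am, map_neg, map_mul]
  P_K := by rw [← map_mul, h.P_K, map_mul]
  P_Kinv := by rw [← map_mul, h.P_Kinv, map_mul]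
  K_Kinv := by rw [← map_mul, h.K_Kinv, map_one]
  Kinv_K := by rw [← map_mul, h.Kinv_K, map_one]
  P_P := by rw [← map_mul, h.P_P, map_one]

/-- The tensor product of two commuting representations, pulled back along the coproduct. -/
def conv (f g : Osp κ →ₐ[ℂ] B) (h : ∀ x y, Commute (f x) (g y)) : Osp κ →ₐ[ℂ] B :=
  (Algebra.TensorProduct.lift f g h).comp (coprod κ)

/-- The family of operators obtained from two families by the formulas of the coproduct. -/
def comb (f g : Gen → B) : Gen → B
  | .Ap => f .Ap * (g .K * g .P) + f .Kinv * g .Ap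
  | .Am => f .Am * (g .K * g .P) + f .Kinv * g .Am
  | .K => f .K * g .K
  | .Kinv => f .Kinv * g .Kinv
  | .P => f .P * g .P

lemma lift_coprodGen (f g : Osp κ →ₐ[ℂ] B) (h : ∀ x y, Commute (f x) (g y)) (x : Gen) :
    Algebra.TensorProduct.lift f g h (coprodGen κ x) =
      comb (fun y => f (gen κ y)) (fun y => g (gen κ y)) x := by
  cases x <;> simp [coprodGen, comb]

lemma conv_gen (f g : Osp κ →ₐ[ℂ] B) (h : ∀ x y, Commute (f x) (g y)) (x : Gen) :
    conv f g h (gen κ x) = comb (fun y => f (gen κ y)) (fun y => g (gen κ y)) x := by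
  rw [← lift_coprodGen f g h, conv, AlgHom.comp_apply, coprod, ospLift_gen]

omit [Algebra ℂ B] in
lemma comb_commute {f g : Gen → B} {b : B} (hf : ∀ x, Commute b (f x))
    (hg : ∀ x, Commute b (g x)) (x : Gen) : Commute b (comb f g x) := by
  cases x
  · exact ((hf _).mul_right ((hg _).mul_right (hg _))).add_right ((hf _).mul_right (hg _))
  · exact ((hf _).mul_right ((hg _).mul_right (hg _))).add_right ((hf _).mul_right (hg _))
  all_goals exact (hf _).mul_right (hg _)

lemma commute_conv {f g : Osp κ →ₐ[ℂ] B} (h : ∀ x y, Commute (f x) (g y)) {b : B}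
    (hf : ∀ x, Commute b (f x)) (hg : ∀ x, Commute b (g x)) (a : Osp κ) :
    Commute b (conv f g h a) :=
  osp_hom_commute (fun x => by
    rw [conv_gen]; exact comb_commute (fun y => hf _) (fun y => hg _) x) a

lemma conv_assoc (f g e : Osp κ →ₐ[ℂ] B) (hfg : ∀ x y, Commute (f x) (g y))
    (hge : ∀ x y, Commute (g x) (e y)) (h1 : ∀ x y, Commute (f x) (conv g e hge y))
    (h2 : ∀ x y, Commute (conv f g hfg x) (e y)) :
    conv f (conv g e hge) h1 = conv (conv f g hfg) e h2 := by
  refine osp_hom_ext fun x => ?_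
  have hc := (hge (gen κ .P) (gen κ .K)).eq
  cases x <;> simp only [conv_gen, comb, add_mul, mul_add, mul_assoc]
  · rw [← mul_assoc (e (gen κ .K)) (g (gen κ .P)), ← hc]
    simp only [mul_assoc, add_assoc]
  · rw [← mul_assoc (e (gen κ .K)) (g (gen κ .P)), ← hc]
    simp only [mul_assoc, add_assoc]

end Hom

/-! ### The Casimir element is central -/

lemma qnum_den_ne_zero {κ : ℂ} (hq : ‖Complex.exp κ‖ ≠ 1) : qpow κ 1 - qpow κ (-1) ≠ 0 := by
  intro h
  rw [qpow_neg, sub_eq_zero] at h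
  apply hq
  have h2 : qpow κ 1 * qpow κ 1 = 1 := by
    nth_rewrite 2 [h]; exact mul_inv_cancel₀ (qpow_ne_zero _ _)
  have h3 : ‖qpow κ 1‖ * ‖qpow κ 1‖ = 1 := by rw [← norm_mul, h2, norm_one]
  have h4 : ‖qpow κ 1‖ = 1 := by nlinarith [norm_nonneg (qpow κ 1)]
  simpa [qpow] using h4

lemma casimir_coeff {κ : ℂ} (hq : ‖Complex.exp κ‖ ≠ 1) :
    (qpow κ (1 / 2) - qpow κ (-(1 / 2)))⁻¹ =
      (qpow κ 1 - qpow κ (-1))⁻¹ * (qpow κ (1 / 2) + qpow κ (-(1 / 2))) := by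
  have h := qnum_den_ne_zero hq
  have h1 : qpow κ 1 - qpow κ (-1) =
      (qpow κ (1 / 2) - qpow κ (-(1 / 2))) * (qpow κ (1 / 2) + qpow κ (-(1 / 2))) := by
    have e1 : qpow κ 1 = qpow κ (1 / 2) * qpow κ (1 / 2) := (qpow_half_mul κ).symm
    have e2 : qpow κ (-1) = qpow κ (-(1 / 2)) * qpow κ (-(1 / 2)) := by
      rw [← qpow_add]; norm_num
    rw [e1, e2]; ring
  rw [h1] at h ⊢
  rw [mul_inv, mul_assoc, inv_mul_cancel₀ (right_ne_zero_of_mul h), mul_one]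

section Casimir

variable {κ : ℂ} {B : Type} [Ring B] [Algebra ℂ B] {f : Gen → B}

/-- The Casimir element without its last factor `P`. -/
def scasimir (κ : ℂ) (f : Gen → B) : B :=
  -(f .Ap * f .Am) + (qpow κ 1 - qpow κ (-1))⁻¹ •
    (qpow κ (-(1 / 2)) • f .K ^ 2 - qpow κ (1 / 2) • f .Kinv ^ 2)

lemma IsOspFamily.scasimir_Ap (h : IsOspFamily κ f) (hq : ‖Complex.exp κ‖ ≠ 1) :
    scasimir κ f * f .Ap = -(f .Ap * scasimir κ f) := by
  have hK : f .K ^ 2 * f .Ap = qpow κ 1 • (f .Ap * f .K ^ 2) := by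
    rw [sq, mul_assoc, h.K_Ap, mul_smul_comm, ← mul_assoc, h.K_Ap, smul_mul_assoc, smul_smul,
      qpow_half_mul, mul_assoc]
  have hKi : f .Kinv ^ 2 * f .Ap = qpow κ (-1) • (f .Ap * f .Kinv ^ 2) := by
    rw [sq, mul_assoc, h.Kinv_Ap, mul_smul_comm, ← mul_assoc, h.Kinv_Ap, smul_mul_assoc,
      smul_smul, ← qpow_add, mul_assoc]
    norm_num
  have hA : f .Am * f .Ap = (qpow κ (1 / 2) - qpow κ (-(1 / 2)))⁻¹ • (f .K ^ 2 - f .Kinv ^ 2)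
      - f .Ap * f .Am := by rw [← h.Ap_Am]; abel
  have e1 : qpow κ (-(1 / 2)) * qpow κ 1 = qpow κ (1 / 2) := by rw [← qpow_add]; norm_num
  have e2 : qpow κ (1 / 2) * qpow κ (-1) = qpow κ (-(1 / 2)) := by rw [← qpow_add]; norm_num
  rw [scasimir, add_mul, neg_mul, mul_assoc, hA, casimir_coeff hq, smul_mul_assoc, sub_mul,
    smul_mul_assoc, smul_mul_assoc, hK, hKi, smul_smul, smul_smul, e1, e2]
  simp only [mul_add, mul_sub, mul_neg, mul_smul_comm]
  module

lemma IsOspFamily.scasimir_Am (h : IsOspFamily κ f) (hq : ‖Complex.exp κ‖ ≠ 1) :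
    scasimir κ f * f .Am = -(f .Am * scasimir κ f) := by
  have hK : f .Am * f .K ^ 2 = qpow κ 1 • (f .K ^ 2 * f .Am) := by
    rw [sq, mul_assoc (f .K), h.K_Am, mul_smul_comm, ← mul_assoc (f .K) (f .Am), h.K_Am, smul_mul_assoc, smul_smul,
      smul_smul, ← qpow_add, ← qpow_add, mul_assoc]
    norm_num [qpow_zero]
  have hKi : f .Am * f .Kinv ^ 2 = qpow κ (-1) • (f .Kinv ^ 2 * f .Am) := by
    rw [sq, mul_assoc (f .Kinv), h.Kinv_Am, mul_smul_comm,
      ← mul_assoc (f .Kinv) (f .Am), h.Kinv_Am,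
      smul_mul_assoc, smul_smul, smul_smul, ← qpow_add, ← qpow_add, mul_assoc]
    norm_num [qpow_zero]
  have hA : f .Am * f .Ap = (qpow κ (1 / 2) - qpow κ (-(1 / 2)))⁻¹ • (f .K ^ 2 - f .Kinv ^ 2)
      - f .Ap * f .Am := by rw [← h.Ap_Am]; abel
  have e1 : qpow κ (-(1 / 2)) * qpow κ 1 = qpow κ (1 / 2) := by rw [← qpow_add]; norm_num
  have e2 : qpow κ (1 / 2) * qpow κ (-1) = qpow κ (-(1 / 2)) := by rw [← qpow_add]; norm_num
  rw [scasimir, mul_add, mul_neg, ← mul_assoc, hA, casimir_coeff hq, mul_smul_comm, mul_sub,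
    mul_smul_comm, mul_smul_comm, hK, hKi, smul_smul, smul_smul, e1, e2]
  simp only [add_mul, sub_mul, neg_mul, smul_mul_assoc]
  module

lemma IsOspFamily.scasimir_P (h : IsOspFamily κ f) : Commute (f .P) (scasimir κ f) := by
  have hA : Commute (f .P) (f .Ap * f .Am) := by
    rw [commute_iff_eq, ← mul_assoc, h.P_Ap, neg_mul, mul_assoc, h.P_Am, mul_neg, neg_neg,
      mul_assoc]
  have hK : Commute (f .P) (f .K) := h.P_K
  have hKi : Commute (f .P) (f .Kinv) := h.P_Kinv
  exact hA.neg_right.add_right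
    ((((hK.pow_right 2).smul_right _).sub_right ((hKi.pow_right 2).smul_right _)).smul_right _)

lemma IsOspFamily.scasimir_K (h : IsOspFamily κ f) : Commute (f .K) (scasimir κ f) := by
  have hA : Commute (f .K) (f .Ap * f .Am) := by
    rw [commute_iff_eq, ← mul_assoc, h.K_Ap, smul_mul_assoc, mul_assoc, h.K_Am, mul_smul_comm,
      smul_smul, ← qpow_add, mul_assoc]
    simp [qpow_zero]
  have hK : Commute (f .K) (f .K) := rfl
  have hKi : Commute (f .K) (f .Kinv) := h.K_Kinv.trans h.Kinv_K.symm
  exact hA.neg_right.add_right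
    ((((hK.pow_right 2).smul_right _).sub_right ((hKi.pow_right 2).smul_right _)).smul_right _)

lemma IsOspFamily.scasimir_P_commute (h : IsOspFamily κ f) (hq : ‖Complex.exp κ‖ ≠ 1) (g : Gen) :
    Commute (scasimir κ f * f .P) (f g) := by
  have hK : Commute (scasimir κ f * f .P) (f .K) := h.scasimir_K.symm.mul_left h.P_K
  cases g
  · rw [commute_iff_eq, mul_assoc, h.P_Ap, mul_neg, ← mul_assoc, h.scasimir_Ap hq, neg_mul,
      neg_neg, mul_assoc]
  · rw [commute_iff_eq, mul_assoc, h.P_Am, mul_neg, ← mul_assoc, h.scasimir_Am hq, neg_mul,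
      neg_neg, mul_assoc]
  · exact hK
  · exact (hK.units_inv_right (u := ⟨f .K, f .Kinv, h.K_Kinv, h.Kinv_K⟩))
  · exact h.scasimir_P.symm.mul_left rfl

lemma map_casimir {φ : Osp κ →ₐ[ℂ] B} (hφ : ∀ g, φ (gen κ g) = f g) :
    φ (casimir κ) = scasimir κ f * f .P := by
  simp [casimir, scasimir, hφ]

end Casimir

/-! ### Operators in different variables commute -/

section Commutation

variable {n : ℕ} {i l : Fin n}

lemma mulX_commute_mulX (i l : Fin n) : Commute (mulX i) (mulX l) :=
  LinearMap.ext fun f => mul_left_comm (MvPolynomial.X i) (MvPolynomial.X l) f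

lemma dilate_commute_dilate (i l : Fin n) (c d : ℂ) : Commute (dilate i c) (dilate l d) :=
  op_ext fun m a => by
    simp only [Module.End.mul_apply, dilate_monomial, map_smul, smul_smul, mul_comm]

lemma dilate_commute_mulX (h : i ≠ l) (c : ℂ) : Commute (dilate i c) (mulX l) :=
  op_ext fun m a => by
    simp [Module.End.mul_apply, dilate_monomial, mulX_monomial, map_smul, h]

lemma divX_monomial_zero (i : Fin n) {m : Fin n →₀ ℕ} (hm : m i = 0) (a : ℂ) :
    divX i (MvPolynomial.monomial m a) = 0 := by
  change (MvPolynomial.monomial m a).divMonomial (Finsupp.single i 1) = 0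
  ext s
  rw [MvPolynomial.coeff_divMonomial, MvPolynomial.coeff_monomial, if_neg, MvPolynomial.coeff_zero]
  rintro rfl
  simp at hm

lemma exponent_cases (i : Fin n) (m : Fin n →₀ ℕ) :
    m i = 0 ∨ ∃ m', m = m' + Finsupp.single i 1 := by
  rcases Nat.eq_zero_or_pos (m i) with hm | hm
  · exact Or.inl hm
  · exact Or.inr
      ⟨m - Finsupp.single i 1, (tsub_add_cancel_of_le (Finsupp.single_le_iff.mpr hm)).symm⟩

lemma divX_commute_mulX (h : i ≠ l) : Commute (divX i) (mulX l) :=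
  op_ext fun m a => by
    simp only [Module.End.mul_apply, mulX_monomial]
    rcases exponent_cases i m with hm | ⟨m, rfl⟩
    · rw [divX_monomial_zero i hm, divX_monomial_zero i (by simp [hm, h]), map_zero]
    · rw [add_right_comm, divX_monomial_add, divX_monomial_add, mulX_monomial]

lemma divX_commute_dilate (h : i ≠ l) (c : ℂ) : Commute (divX i) (dilate l c) :=
  op_ext fun m a => by
    simp only [Module.End.mul_apply, dilate_monomial, map_smul]
    rcases exponent_cases i m with hm | ⟨m, rfl⟩
    · rw [divX_monomial_zero i hm, map_zero, smul_zero]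
    · rw [divX_monomial_add, dilate_monomial]
      simp [h.symm]

lemma divX_commute_divX (i l : Fin n) : Commute (divX i) (divX l) :=
  LinearMap.ext fun f => by
    change (f.divMonomial _).divMonomial _ = (f.divMonomial _).divMonomial _
    rw [← MvPolynomial.divMonomial_add, ← MvPolynomial.divMonomial_add, add_comm]

lemma commute_realGen {T : Op n} (κ : ℂ) (μ : Fin n → ℝ) (hX : Commute T (mulX l))
    (hd : Commute T (divX l)) (hs : ∀ c, Commute T (dilate l c)) (g : Gen) :
    Commute T (realGen κ μ l g) := by
  cases g
  · exact hX
  · exact ((hd.mul_right ((hs _).sub_right (hs _))).smul_right _).sub_right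
      ((hd.mul_right ((hs _).sub_right (hs _))).smul_right _)
  · exact (hs _).smul_right _
  · exact (hs _).smul_right _
  · exact hs _

lemma realGen_commute_realGen (κ : ℂ) (μ : Fin n → ℝ) (h : i ≠ l) (g g' : Gen) :
    Commute (realGen κ μ i g) (realGen κ μ l g') := by
  refine commute_realGen κ μ ?_ ?_ (fun c => ?_) g' <;> refine Commute.symm ?_
  · exact commute_realGen κ μ (mulX_commute_mulX _ _) (divX_commute_mulX h).symm
      (fun c => (dilate_commute_mulX h c).symm) g
  · exact commute_realGen κ μ (divX_commute_mulX h.symm) (divX_commute_divX _ _)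
      (fun c => divX_commute_dilate h.symm c) g
  · exact commute_realGen κ μ (dilate_commute_mulX h.symm _) (divX_commute_dilate h c).symm
      (fun c => dilate_commute_dilate _ _ _ _) g

end Commutation

/-! ### The realization of the iterated coproduct in the first `m` variables -/

section Partial

variable {n : ℕ} (κ : ℂ) (hq : ‖Complex.exp κ‖ ≠ 1) (μ : Fin n → ℝ)

/-- The realization of the generators, through the iterated coproduct, in the first `m`
variables. -/
def partFam : ℕ → Gen → Op n
  | 0 => fun g => match g with
    | .Ap => 0
    | .Am => 0
    | _ => 1
  | m + 1 => if h : m < n then comb (partFam m) (realGen κ μ ⟨m, h⟩) else partFam m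

lemma partFam_succ (i : Fin n) :
    partFam κ μ (i.val + 1) = comb (partFam κ μ i.val) (realGen κ μ i) := by
  rw [partFam, dif_pos i.isLt]

lemma commute_partFam_of_le {T : Op n} {m₀ m : ℕ} (h₀ : ∀ g, Commute T (partFam κ μ m₀ g))
    (hm : m₀ ≤ m) (hmn : m ≤ n)
    (h : ∀ i : Fin n, m₀ ≤ i.val → i.val < m → ∀ g, Commute T (realGen κ μ i g)) :
    ∀ g, Commute T (partFam κ μ m g) := by
  induction m, hm using Nat.le_induction with
  | base => exact h₀
  | succ m hm ih =>
    intro g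
    rw [partFam_succ κ μ ⟨m, hmn⟩]
    exact comb_commute (ih (by omega) fun i h1 h2 => h i h1 (by omega))
      (h ⟨m, hmn⟩ hm (Nat.lt_succ_self m)) g

lemma commute_partFam_zero (T : Op n) (g : Gen) : Commute T (partFam κ μ 0 g) := by
  cases g
  · exact Commute.zero_right T
  · exact Commute.zero_right T
  all_goals exact Commute.one_right T

lemma realGen_commute_partFam (i : Fin n) {m : ℕ} (hm : m ≤ i.val) (g g' : Gen) :
    Commute (realGen κ μ i g) (partFam κ μ m g') := by
  exact commute_partFam_of_le κ μ (commute_partFam_zero κ μ _) (Nat.zero_le m)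
    (hm.trans i.isLt.le) (fun l _ hl x =>
      realGen_commute_realGen κ μ (Fin.ne_of_val_ne (by omega)) g x) g'

include hq in
lemma isOspFamily_partFam (m : ℕ) (hm : m ≤ n) : IsOspFamily κ (partFam κ μ m) := by
  induction m with
  | zero => constructor <;> simp [partFam]
  | succ m ih =>
    have h1 := ih (by omega)
    let i : Fin n := ⟨m, hm⟩
    have hc : ∀ x y, Commute (ospLift κ _ h1 x) (realVar κ hq μ i y) :=
      osp_hom_commute_hom fun x y => by
        rw [realVar, ospLift_gen, ospLift_gen]
        exact (realGen_commute_partFam κ μ i le_rfl y x).symm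
    have h2 := (isOspFamily_coprodGen κ).map (Algebra.TensorProduct.lift _ _ hc)
    rw [partFam_succ κ μ i]
    convert h2 using 2 with x
    rw [lift_coprodGen]
    simp only [realVar, ospLift_gen]
    rfl

/-- The representation of `osp_q(1|2)` in the first `m` variables. -/
def partHom (m : ℕ) (hm : m ≤ n) : Osp κ →ₐ[ℂ] Op n :=
  ospLift κ (partFam κ μ m) (isOspFamily_partFam κ hq μ m hm)

lemma partHom_gen (m : ℕ) (hm : m ≤ n) (g : Gen) :
    partHom κ hq μ m hm (gen κ g) = partFam κ μ m g := ospLift_gen _ _ _ _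

lemma realVar_gen (i : Fin n) (g : Gen) : realVar κ hq μ i (gen κ g) = realGen κ μ i g :=
  ospLift_gen _ _ _ _

lemma partHom_commute_realVar (i : Fin n) {m : ℕ} (hm : m ≤ i.val) (x y : Osp κ) :
    Commute (partHom κ hq μ m (hm.trans i.isLt.le) x) (realVar κ hq μ i y) :=
  osp_hom_commute_hom (fun x y => by
    rw [partHom_gen, realVar_gen]
    exact (realGen_commute_partFam κ μ i hm y x).symm) x y

lemma partHom_succ (i : Fin n) :
    partHom κ hq μ (i.val + 1) i.isLt = conv (partHom κ hq μ i.val i.isLt.le)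
      (realVar κ hq μ i) (partHom_commute_realVar κ hq μ i le_rfl) := by
  refine osp_hom_ext fun g => ?_
  rw [conv_gen, partHom_gen, partFam_succ]
  simp only [partHom_gen, realVar_gen]

/-! ### The operators `Γ_{[ℓ]}^q` as images of the Casimir element -/

/-- The realization of `osp_q(1|2)^{⊗ m}` in the first `m` variables. -/
def realizeFirst (m : ℕ) (hm : m ≤ n) : OspPow κ m →ₗ[ℂ] Op n :=
  PiTensorProduct.lift ((MultilinearMap.mkPiAlgebraFin ℂ m (Op n)).compLinearMap
    (fun i => (realVar κ hq μ (Fin.castLE hm i)).toLinearMap))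

lemma realizeFirst_tprod (m : ℕ) (hm : m ≤ n) (a : Fin m → Osp κ) :
    realizeFirst κ hq μ m hm (PiTensorProduct.tprod ℂ a) =
      (List.ofFn fun i => realVar κ hq μ (Fin.castLE hm i) (a i)).prod := by
  rw [realizeFirst, PiTensorProduct.lift.tprod]
  simp [MultilinearMap.mkPiAlgebraFin_apply]

/-- The realization of `osp_q(1|2)^{⊗ (k + 1)}` in which the last factor acts through `ρ`. -/
def realizeLast (k : ℕ) (hk : k ≤ n) (ρ : Osp κ →ₐ[ℂ] Op n) : OspPow κ k ⊗[ℂ] Osp κ →ₗ[ℂ] Op n :=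
  LinearMap.mul' ℂ (Op n) ∘ₗ TensorProduct.map (realizeFirst κ hq μ k hk) ρ.toLinearMap

lemma realizeFirst_snocEquiv (i : Fin n) (t : OspPow κ i.val ⊗[ℂ] Osp κ) :
    realizeFirst κ hq μ (i.val + 1) i.isLt (snocEquiv κ i.val t) =
      realizeLast κ hq μ i.val i.isLt.le (realVar κ hq μ i) t := by
  induction t with
  | zero => simp
  | add x y hx hy => simp only [map_add, hx, hy]
  | tmul a b =>
    induction a using PiTensorProduct.induction_on with
    | add x y hx hy => simp only [TensorProduct.add_tmul, map_add, hx, hy]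
    | smul_tprod c a =>
      rw [← TensorProduct.smul_tmul', map_smul, map_smul, map_smul, snocEquiv_tmul,
        realizeFirst_tprod, List.ofFn_succ', List.concat_eq_append, List.prod_append]
      simp [realizeLast, realizeFirst_tprod]
      rfl

lemma realizeLast_lastCoprod (i : Fin n) (ρ : Osp κ →ₐ[ℂ] Op n)
    (h : ∀ x y, Commute (realVar κ hq μ i x) (ρ y)) (t : OspPow κ (i.val + 1)) :
    realizeLast κ hq μ (i.val + 1) i.isLt ρ
        ((snocEquiv κ (i.val + 1)).symm (lastCoprod κ i.val t)) =
      realizeLast κ hq μ i.val i.isLt.le (conv (realVar κ hq μ i) ρ h)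
        ((snocEquiv κ i.val).symm t) := by
  simp only [lastCoprod, LinearMap.comp_apply, LinearEquiv.coe_coe, LinearEquiv.symm_apply_apply]
  generalize (snocEquiv κ i.val).symm t = z
  induction z with
  | zero => simp
  | add x y hx hy => simp only [map_add, hx, hy]
  | tmul a b =>
    simp only [TensorProduct.map_tmul, LinearMap.id_apply, realizeLast, LinearMap.comp_apply,
      AlgHom.toLinearMap_apply, LinearMap.mul'_apply, conv, AlgHom.comp_apply]
    generalize coprod κ b = w
    induction w with
    | zero => simp
    | add x y hx hy => simp only [TensorProduct.tmul_add, map_add, hx, hy, mul_add]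
    | tmul c d =>
      simp [realizeFirst_snocEquiv, realizeLast, mul_assoc]

lemma realizeLast_iterCasimir (k : ℕ) (hk : k ≤ n) (ρ : Osp κ →ₐ[ℂ] Op n)
    (h : ∀ i : Fin n, i.val < k → ∀ x y, Commute (realVar κ hq μ i x) (ρ y))
    (h' : ∀ x y, Commute (partHom κ hq μ k hk x) (ρ y)) :
    realizeLast κ hq μ k hk ρ ((snocEquiv κ k).symm (iterCasimir κ k)) =
      conv (partHom κ hq μ k hk) ρ h' (casimir κ) := by
  induction k generalizing ρ with
  | zero =>
    have h1 : conv (partHom κ hq μ 0 hk) ρ h' = ρ := by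
      refine osp_hom_ext fun g => ?_
      rw [conv_gen]
      simp only [partHom_gen]
      cases g <;> simp [comb, partFam]
    have h2 : iterCasimir κ 0 = snocEquiv κ 0
        (PiTensorProduct.tprod ℂ (fun _ : Fin 0 => (1 : Osp κ)) ⊗ₜ[ℂ] casimir κ) := by
      rw [snocEquiv_tmul, iterCasimir]
      congr 1
    rw [h1, h2, LinearEquiv.symm_apply_apply]
    simp [realizeLast, realizeFirst_tprod]
  | succ k ih =>
    let i : Fin n := ⟨k, hk⟩
    have hi : ∀ x y, Commute (realVar κ hq μ i x) (ρ y) := h i (Nat.lt_succ_self k)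
    have hcomm : ∀ x y, Commute (partHom κ hq μ k i.isLt.le x) (ρ y) := by
      refine osp_hom_commute_hom fun x y => ?_
      rw [partHom_gen]
      refine (commute_partFam_of_le κ μ (commute_partFam_zero κ μ _) (Nat.zero_le k) i.isLt.le
        (fun l _ hl g => ?_) x).symm
      rw [← realVar_gen κ hq μ l]
      exact (h l (by omega) _ _).symm
    rw [iterCasimir, realizeLast_lastCoprod κ hq μ i ρ hi,
      ih i.isLt.le (conv (realVar κ hq μ i) ρ hi)
        (fun l hl x => commute_conv hi
          (osp_hom_commute_hom (fun x y => by
            rw [realVar_gen, realVar_gen]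
            exact realGen_commute_realGen κ μ (Fin.ne_of_val_ne (by simp [i]; omega)) x y) x)
          (h l (by omega) x))
        (fun x => commute_conv hi (partHom_commute_realVar κ hq μ i le_rfl x) (hcomm x)),
      conv_assoc _ _ _ (partHom_commute_realVar κ hq μ i le_rfl) hi _
        (fun x y => by rw [← partHom_succ κ hq μ i]; exact h' x y)]
    congr 1
    simp only [partHom_succ κ hq μ i, i]

lemma realizeFirst_casimirPow (ℓ : ℕ) (h1 : 1 ≤ ℓ) (hℓ : ℓ ≤ n) (m : ℕ) (hm : m ≤ n)
    (hℓm : ℓ ≤ m) :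
    realizeFirst κ hq μ m hm (casimirPow κ m ℓ) = partHom κ hq μ ℓ hℓ (casimir κ) := by
  induction m, hℓm using Nat.le_induction with
  | base =>
    obtain ⟨k, rfl⟩ : ∃ k, ℓ = k + 1 := ⟨ℓ - 1, by omega⟩
    let i : Fin n := ⟨k, hℓ⟩
    have h2 := realizeFirst_snocEquiv κ hq μ i ((snocEquiv κ k).symm (iterCasimir κ k))
    rw [LinearEquiv.apply_symm_apply, realizeLast_iterCasimir κ hq μ k _ _
      (fun l hl => osp_hom_commute_hom (fun x y => by
            rw [realVar_gen, realVar_gen]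
            exact realGen_commute_realGen κ μ (Fin.ne_of_val_ne (by simp [i]; omega)) x y))
      (partHom_commute_realVar κ hq μ i le_rfl), ← partHom_succ κ hq μ i] at h2
    rw [casimirPow, if_neg (by omega)]
    exact h2
  | succ m hm' ih =>
    let i : Fin n := ⟨m, hm⟩
    rw [casimirPow, if_pos hm', realizeFirst_snocEquiv κ hq μ i]
    simp [realizeLast, ih i.isLt.le, i]

lemma sphericalGamma_eq (ℓ : ℕ) (h1 : 1 ≤ ℓ) (hℓ : ℓ ≤ n) :
    sphericalGamma κ hq μ ℓ = scasimir κ (partFam κ μ ℓ) * partFam κ μ ℓ .P := by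
  rw [← map_casimir (partHom_gen κ hq μ ℓ hℓ), ← realizeFirst_casimirPow κ hq μ ℓ h1 hℓ n le_rfl hℓ]
  rfl

lemma sphericalGamma_commute_partFam (ℓ m : ℕ) (h1 : 1 ≤ ℓ) (hℓ : ℓ ≤ m) (hm : m ≤ n) (g : Gen) :
    Commute (sphericalGamma κ hq μ ℓ) (partFam κ μ m g) := by
  have hF := isOspFamily_partFam κ hq μ ℓ (hℓ.trans hm)
  rw [sphericalGamma_eq κ hq μ ℓ h1 (hℓ.trans hm)]
  refine commute_partFam_of_le κ μ (hF.scasimir_P_commute hq) hℓ hm (fun i hi _ x => ?_) g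
  rw [← map_casimir (partHom_gen κ hq μ ℓ (hℓ.trans hm)), ← realVar_gen κ hq μ i]
  exact partHom_commute_realVar κ hq μ i hi _ _

lemma sphericalGamma_commute_realGen (ℓ : ℕ) (h1 : 1 ≤ ℓ) (i : Fin n) (hi : ℓ ≤ i.val) (g : Gen) :
    Commute (sphericalGamma κ hq μ ℓ) (realGen κ μ i g) := by
  rw [sphericalGamma_eq κ hq μ ℓ h1 (hi.trans i.isLt.le),
    ← map_casimir (partHom_gen κ hq μ ℓ (hi.trans i.isLt.le)), ← realVar_gen κ hq μ i]
  exact partHom_commute_realVar κ hq μ i hi _ _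

end Partial

/-! ### Operators that are diagonal on monomials -/

section Diagonal

variable {n : ℕ}

/-- The operator `T` multiplies the monomial with exponent `s` by `c s`. -/
def IsDiag (T : Op n) (c : (Fin n →₀ ℕ) → ℂ) : Prop :=
  ∀ s a, T (MvPolynomial.monomial s a) = c s • MvPolynomial.monomial s a

lemma IsDiag.mul {T T' : Op n} {c c' : (Fin n →₀ ℕ) → ℂ} (h : IsDiag T c) (h' : IsDiag T' c') :
    IsDiag (T * T') (fun s => c s * c' s) := fun s a => by
  rw [Module.End.mul_apply, h' s a, map_smul, h s a, smul_smul, mul_comm]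

lemma IsDiag.one : IsDiag (1 : Op n) (fun _ => 1) := fun s a => by simp

lemma IsDiag.ext {T T' : Op n} {c c' : (Fin n →₀ ℕ) → ℂ} (h : IsDiag T c) (h' : IsDiag T' c')
    (hc : ∀ s, c s = c' s) : T = T' := op_ext fun s a => by rw [h, h', hc]

lemma IsDiag.congr {T : Op n} {c c' : (Fin n →₀ ℕ) → ℂ} (h : IsDiag T c)
    (hc : ∀ s, c s = c' s) : IsDiag T c' := fun s a => by rw [h, hc]

lemma IsDiag.coeff {T : Op n} {c : (Fin n →₀ ℕ) → ℂ} (h : IsDiag T c) (u : Fin n →₀ ℕ)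
    (f : Poly n) : (T f).coeff u = c u * f.coeff u := by
  induction f using MvPolynomial.induction_on' with
  | monomial s a =>
    rw [h, MvPolynomial.coeff_smul, smul_eq_mul, MvPolynomial.coeff_monomial]
    split_ifs with hs
    · rw [hs]
    · simp
  | add f g h1 h2 => rw [map_add, MvPolynomial.coeff_add, MvPolynomial.coeff_add, h1, h2, mul_add]

lemma IsDiag.ofFn {m : ℕ} {T : Fin m → Op n} {c : Fin m → (Fin n →₀ ℕ) → ℂ}
    (h : ∀ l, IsDiag (T l) (c l)) : IsDiag (List.ofFn T).prod (fun s => ∏ l, c l s) := by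
  induction m with
  | zero => simpa using IsDiag.one
  | succ m ih =>
    rw [List.ofFn_succ, List.prod_cons]
    simp only [Fin.prod_univ_succ]
    exact (h 0).mul (ih fun l => h l.succ)

lemma IsDiag.ite {P : Prop} [Decidable P] {T T' : Op n} {c c' : (Fin n →₀ ℕ) → ℂ}
    (h : IsDiag T c) (h' : IsDiag T' c') :
    IsDiag (if P then T else T') (fun s => if P then c s else c' s) := by
  split_ifs
  · exact h
  · exact h'

variable (κ : ℂ) (μ : Fin n → ℝ)

lemma qpow_pow (x : ℝ) (m : ℕ) : qpow κ x ^ m = qpow κ (m * x) := by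
  rw [qpow, qpow, ← Complex.exp_nat_mul]
  congr 1; push_cast; ring

lemma isDiag_opK (i : Fin n) : IsDiag (opK κ μ i) (fun s => qpow κ ((gam μ i + s i) / 2)) := by
  intro s a
  simp only [opK, qshift, LinearMap.smul_apply, dilate_monomial, smul_smul, qpow_pow, ← qpow_add]
  congr 2; ring

lemma isDiag_opKinv (i : Fin n) :
    IsDiag (opKinv κ μ i) (fun s => qpow κ (-((gam μ i + s i) / 2))) := by
  intro s a
  simp only [opKinv, qshift, LinearMap.smul_apply, dilate_monomial, smul_smul, qpow_pow,
    ← qpow_add]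
  congr 2; ring

lemma isDiag_reflOp (i : Fin n) : IsDiag (reflOp i) (fun s => (-1) ^ s i) :=
  fun s a => dilate_monomial i _ s a

@[to_additive]
lemma prod_lt_succ {M : Type*} [CommMonoid M] (f : Fin n → M) (i : Fin n) :
    ∏ l : Fin n, (if l.val < i.val + 1 then f l else 1) =
      (∏ l : Fin n, if l.val < i.val then f l else 1) * f i := by
  have h : f i = ∏ l : Fin n, if l = i then f l else 1 := by simp
  rw [h, ← Finset.prod_mul_distrib]
  refine Finset.prod_congr rfl fun l _ => ?_
  rcases lt_trichotomy l.val i.val with h | h | h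
  · rw [if_pos (by omega), if_pos h, if_neg (Fin.ne_of_val_ne h.ne), mul_one]
  · rw [if_pos (by omega), if_neg (by omega), if_pos (Fin.ext h), one_mul]
  · rw [if_neg (by omega), if_neg (by omega), if_neg (Fin.ne_of_val_ne h.ne'), mul_one]

lemma gamSum_succ (i : Fin n) : gamSum μ (i.val + 1) = gamSum μ i.val + gam μ i :=
  sum_lt_succ _ i

/-- The degree of a monomial in the first `m` variables. -/
def degSum (m : ℕ) (s : Fin n →₀ ℕ) : ℕ := ∑ l : Fin n, if l.val < m then s l else 0

lemma isDiag_partFam_K (m : ℕ) (hm : m ≤ n) :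
    IsDiag (partFam κ μ m .K) (fun s => qpow κ ((gamSum μ m + degSum m s) / 2)) := by
  induction m with
  | zero =>
    intro s a
    simp [partFam, gamSum, degSum, qpow_zero]
  | succ m ih =>
    let i : Fin n := ⟨m, hm⟩
    rw [partFam_succ κ μ i]
    refine ((ih (by omega)).mul (isDiag_opK κ μ i)).congr fun s => ?_
    have h1 : gamSum μ (m + 1) = gamSum μ m + gam μ i := gamSum_succ μ i
    have h2 : degSum (m + 1) s = degSum m s + s i := sum_lt_succ _ i
    rw [← qpow_add, h1, h2]
    congr 1
    push_cast
    ring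

lemma isDiag_partFam_P (m : ℕ) (hm : m ≤ n) :
    IsDiag (partFam κ μ m .P) (fun s => (-1) ^ degSum m s) := by
  induction m with
  | zero =>
    intro s a
    simp [partFam, degSum]
  | succ m ih =>
    let i : Fin n := ⟨m, hm⟩
    rw [partFam_succ κ μ i]
    refine ((ih (by omega)).mul (isDiag_reflOp i)).congr fun s => ?_
    have h2 : degSum (m + 1) s = degSum m s + s i := sum_lt_succ _ i
    rw [← pow_add, h2]

lemma isDiag_partFam_Kinv (m : ℕ) (hm : m ≤ n) :
    IsDiag (partFam κ μ m .Kinv)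
      (fun s => ∏ l : Fin n, if l.val < m then qpow κ (-((gam μ l + s l) / 2)) else 1) := by
  induction m with
  | zero =>
    intro s a
    simp [partFam]
  | succ m ih =>
    let i : Fin n := ⟨m, hm⟩
    rw [partFam_succ κ μ i]
    exact ((ih (by omega)).mul (isDiag_opKinv κ μ i)).congr fun s =>
      (prod_lt_succ (fun l => qpow κ (-((gam μ l + s l) / 2))) i).symm

/-- The product of the reflections in the variables after the first `m` ones. -/
def reflAfter (n m : ℕ) : Op n :=
  (List.ofFn fun l : Fin n => if l.val < m then 1 else reflOp l).prod

lemma isDiag_reflAfter (m : ℕ) :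
    IsDiag (reflAfter n m) (fun s => ∏ l : Fin n, if l.val < m then 1 else (-1) ^ s l) :=
  IsDiag.ofFn fun l => IsDiag.one.ite (isDiag_reflOp l)

lemma isDiag_opR (m : ℕ) (k : Fin n) :
    IsDiag (opR κ μ m k) (fun s => ∏ l : Fin n,
      if l < k then qpow κ (-((gam μ l + s l) / 2)) else if l = k then 1
      else if l.val < m then qpow κ ((gam μ l + s l) / 2) * (-1) ^ s l else (-1) ^ s l) :=
  IsDiag.ofFn fun l => (isDiag_opKinv κ μ l).ite
    (IsDiag.one.ite (((isDiag_opK κ μ l).mul (isDiag_reflOp l)).ite (isDiag_reflOp l)))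

lemma reflAfter_eq (i : Fin n) : reflAfter n i.val = reflOp i * reflAfter n (i.val + 1) := by
  refine (isDiag_reflAfter _).ext ((isDiag_reflOp i).mul (isDiag_reflAfter _)) fun s => ?_
  have h : (-1 : ℂ) ^ s i = ∏ l : Fin n, if l = i then (-1) ^ s l else 1 := by simp
  rw [h, ← Finset.prod_mul_distrib]
  refine Finset.prod_congr rfl fun l _ => ?_
  rcases lt_trichotomy l.val i.val with h | h | h
  · rw [if_pos (by omega), if_neg (Fin.ne_of_val_ne h.ne), if_pos (by omega), mul_one]
  · rw [if_neg (by omega), if_pos (Fin.ext h), if_pos (by omega), mul_one]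
  · rw [if_neg (by omega), if_neg (Fin.ne_of_val_ne h.ne'), if_neg (by omega), one_mul]

lemma opR_succ_of_lt (i k : Fin n) (hk : k < i) :
    opR κ μ (i.val + 1) k = opR κ μ i.val k * opK κ μ i := by
  refine (isDiag_opR κ μ _ k).ext ((isDiag_opR κ μ _ k).mul (isDiag_opK κ μ i)) fun s => ?_
  have h : qpow κ ((gam μ i + s i) / 2) =
      ∏ l : Fin n, if l = i then qpow κ ((gam μ l + s l) / 2) else 1 := by simp
  rw [h, ← Finset.prod_mul_distrib]
  refine Finset.prod_congr rfl fun l _ => ?_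
  by_cases hl : l = i
  · subst hl
    rw [if_neg hk.not_gt, if_neg hk.ne', if_neg hk.not_gt, if_neg hk.ne', if_pos (by omega),
      if_neg (by omega), if_pos rfl, mul_comm]
  · have h1 : l.val < i.val + 1 ↔ l.val < i.val := by
      have := Fin.val_ne_of_ne hl
      omega
    simp only [h1, if_neg hl, mul_one]

lemma opR_succ_self (i : Fin n) :
    opR κ μ (i.val + 1) i = partFam κ μ i.val .Kinv * reflAfter n (i.val + 1) := by
  refine (isDiag_opR κ μ _ i).ext ((isDiag_partFam_Kinv κ μ _ i.isLt.le).mul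
    (isDiag_reflAfter _)) fun s => ?_
  rw [← Finset.prod_mul_distrib]
  refine Finset.prod_congr rfl fun l _ => ?_
  rcases lt_trichotomy l i with h | h | h
  · rw [if_pos h, if_pos (Fin.lt_def.mp h), if_pos (by omega), mul_one]
  · subst h
    simp
  · rw [if_neg h.not_gt, if_neg h.ne', if_neg (by omega), if_neg (by omega), if_neg (by omega),
      one_mul]

lemma sum_mul_opR (T : Fin n → Op n) (F : ℕ → Op n) (h0 : F 0 = 0)
    (hF : ∀ i : Fin n, F (i.val + 1) = F i.val * (opK κ μ i * reflOp i) +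
      partFam κ μ i.val .Kinv * T i)
    (hT : ∀ i : Fin n, Commute (T i) (partFam κ μ i.val .Kinv)) (m : ℕ) (hm : m ≤ n) :
    (∑ k : Fin n, if k.val < m then T k * opR κ μ m k else 0) = F m * reflAfter n m := by
  induction m with
  | zero => simp [h0]
  | succ m ih =>
    let i : Fin n := ⟨m, hm⟩
    have h1 : opK κ μ i * reflOp i * reflAfter n (i.val + 1) = reflAfter n i.val * opK κ μ i := by
      rw [mul_assoc, ← reflAfter_eq]
      exact ((isDiag_opK κ μ i).mul (isDiag_reflAfter _)).ext
        ((isDiag_reflAfter _).mul (isDiag_opK κ μ i)) fun s => mul_comm _ _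
    refine (sum_lt_succ (fun k => T k * opR κ μ (m + 1) k) i).trans ?_
    change _ = F (i.val + 1) * reflAfter n (i.val + 1)
    rw [hF i, add_mul, mul_assoc, h1, ← mul_assoc, ← ih (by omega), Finset.sum_mul,
      opR_succ_self κ μ i, ← mul_assoc (T i), (hT i).eq]
    congr 1
    refine Finset.sum_congr rfl fun k _ => ?_
    split_ifs with hk
    · rw [mul_assoc, ← opR_succ_of_lt κ μ i k hk]
    · rw [zero_mul]

lemma opX_eq (m : ℕ) (hm : m ≤ n) : opX κ μ m = partFam κ μ m .Ap * reflAfter n m :=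
  sum_mul_opR κ μ mulX (fun m => partFam κ μ m .Ap) rfl
    (fun i => by rw [partFam_succ]; rfl)
    (fun i => realGen_commute_partFam κ μ i le_rfl .Ap .Kinv) m hm

lemma opD_eq (m : ℕ) (hm : m ≤ n) : opD κ μ m = partFam κ μ m .Am * reflAfter n m :=
  sum_mul_opR κ μ (dunkl κ μ) (fun m => partFam κ μ m .Am) rfl
    (fun i => by rw [partFam_succ]; rfl)
    (fun i => realGen_commute_partFam κ μ i le_rfl .Am .Kinv) m hm

lemma sphericalGamma_commute_reflAfter (hq : ‖Complex.exp κ‖ ≠ 1) (ℓ m : ℕ) (h1 : 1 ≤ ℓ)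
    (hℓ : ℓ ≤ m) : Commute (sphericalGamma κ hq μ ℓ) (reflAfter n m) := by
  refine Commute.list_prod_right _ _ fun x hx => ?_
  obtain ⟨l, rfl⟩ := (List.mem_ofFn' _ _).mp hx
  dsimp only
  split_ifs with h
  · exact Commute.one_right _
  · exact sphericalGamma_commute_realGen κ hq μ ℓ h1 l (by omega) .P

lemma sphericalGamma_commute_opX (hq : ‖Complex.exp κ‖ ≠ 1) (ℓ m : ℕ) (h1 : 1 ≤ ℓ)
    (hℓ : ℓ ≤ m) (hm : m ≤ n) : Commute (sphericalGamma κ hq μ ℓ) (opX κ μ m) := by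
  rw [opX_eq κ μ m hm]
  exact (sphericalGamma_commute_partFam κ hq μ ℓ m h1 hℓ hm _).mul_right
    (sphericalGamma_commute_reflAfter κ μ hq ℓ m h1 hℓ)

lemma sphericalGamma_commute_opD (hq : ‖Complex.exp κ‖ ≠ 1) (ℓ m : ℕ) (h1 : 1 ≤ ℓ)
    (hℓ : ℓ ≤ m) (hm : m ≤ n) : Commute (sphericalGamma κ hq μ ℓ) (opD κ μ m) := by
  rw [opD_eq κ μ m hm]
  exact (sphericalGamma_commute_partFam κ hq μ ℓ m h1 hℓ hm _).mul_right
    (sphericalGamma_commute_reflAfter κ μ hq ℓ m h1 hℓ)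

lemma sphericalGamma_commute_CK (hq : ‖Complex.exp κ‖ ≠ 1) (ℓ : ℕ) (h1 : 1 ≤ ℓ) (i : Fin n)
    (hi : ℓ ≤ i.val) (k : ℕ) : Commute (sphericalGamma κ hq μ ℓ) (CK κ μ i k) :=
  Commute.sum_right _ _ _ fun α _ =>
    (((sphericalGamma_commute_realGen κ hq μ ℓ h1 i hi .Ap).pow_right α).mul_right
      ((sphericalGamma_commute_opD κ μ hq ℓ i.val h1 hi i.isLt.le).pow_right α)).smul_right _

end Diagonal

/-! ### Norms of `q`-powers -/

lemma norm_qpow_eq_one {κ : ℂ} (hq : ‖Complex.exp κ‖ ≠ 1) {x : ℝ} (h : ‖qpow κ x‖ = 1) :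
    x = 0 := by
  rw [qpow, Complex.norm_exp, Real.exp_eq_one_iff, Complex.re_mul_ofReal] at h
  refine (mul_eq_zero.mp h).resolve_left fun h0 => hq ?_
  rw [Complex.norm_exp, h0, Real.exp_zero]

lemma qpow_injective {κ : ℂ} (hq : ‖Complex.exp κ‖ ≠ 1) {x y : ℝ} (h : qpow κ x = qpow κ y) :
    x = y := by
  have h1 : qpow κ (x - y) = 1 := by
    rw [sub_eq_add_neg, qpow_add, h, ← qpow_add, add_neg_cancel, qpow_zero]
  exact sub_eq_zero.mp (norm_qpow_eq_one hq (by rw [h1, norm_one]))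

lemma qbracket_ne_zero {κ : ℂ} (hq : ‖Complex.exp κ‖ ≠ 1) {μ : ℝ} (hμ : 0 < μ) {m : ℕ}
    (hm : 1 ≤ m) : qbracket κ μ m ≠ 0 := by
  have hm' : (1 : ℝ) ≤ m := by exact_mod_cast hm
  have hb : ∀ c : ℂ, ‖c‖ = 1 → qpow κ m - c ≠ 0 := by
    intro c hc h
    have := norm_qpow_eq_one hq (x := m) (by rw [sub_eq_zero.mp h, hc])
    linarith
  have ha : ∀ c : ℂ, ‖c‖ = 1 → qpow κ μ ^ 2 * qpow κ m - c ≠ 0 := by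
    intro c hc h
    have h1 : qpow κ (μ + μ + m) = c := by
      rw [qpow_add, qpow_add, ← sq]; exact sub_eq_zero.mp h
    have := norm_qpow_eq_one hq (x := μ + μ + m) (by rw [h1, hc])
    linarith
  have h0 := qpow_ne_zero κ μ
  have h1 := qpow_ne_zero κ m
  have hd := qnum_den_ne_zero hq
  intro h
  rw [qbracket, qnum, qnum, qpow_neg κ (μ + m), qpow_neg κ μ, qpow_add] at h
  rcases m.even_or_odd with he | ho
  · rw [he.neg_one_pow] at h
    refine mul_ne_zero (hb 1 (by simp)) (ha (-1) (by simp)) ?_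
    field_simp at h
    linear_combination h
  · rw [ho.neg_one_pow] at h
    refine mul_ne_zero (hb (-1) (by simp)) (ha 1 (by simp)) ?_
    field_simp at h
    linear_combination h

/-! ### Homogeneous polynomials in the first `m` variables -/

section Homogeneous

variable {n : ℕ}

/-- The exponents of degree `k` involving only the first `m` variables. -/
def expo (n m k : ℕ) : Set (Fin n →₀ ℕ) := {s | (∀ l, m ≤ l.val → s l = 0) ∧ ∑ l, s l = k}

/-- Homogeneous polynomials of degree `k` in the first `m` variables. -/
def homPoly (n m k : ℕ) : Submodule ℂ (Poly n) :=
  Submodule.span ℂ ((fun s => MvPolynomial.monomial s (1 : ℂ)) '' expo n m k)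

lemma monomial_mem_homPoly {m k : ℕ} {s : Fin n →₀ ℕ} (hs : s ∈ expo n m k) (a : ℂ) :
    MvPolynomial.monomial s a ∈ homPoly n m k := by
  have h := (homPoly n m k).smul_mem a (Submodule.subset_span (Set.mem_image_of_mem _ hs))
  simpa [MvPolynomial.smul_monomial] using h

lemma map_mem_of_mem_homPoly {m k : ℕ} {T : Op n} {U : Submodule ℂ (Poly n)}
    (h : ∀ s ∈ expo n m k, T (MvPolynomial.monomial s 1) ∈ U) {p : Poly n}
    (hp : p ∈ homPoly n m k) : T p ∈ U := by
  have h1 : homPoly n m k ≤ U.comap T := by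
    refine Submodule.span_le.mpr ?_
    rintro _ ⟨s, hs, rfl⟩
    exact h s hs
  exact h1 hp

lemma eq_of_mem_homPoly {m k : ℕ} {T T' : Op n}
    (h : ∀ s ∈ expo n m k, T (MvPolynomial.monomial s 1) = T' (MvPolynomial.monomial s 1))
    {p : Poly n} (hp : p ∈ homPoly n m k) : T p = T' p := by
  refine LinearMap.eqOn_span ?_ hp
  rintro _ ⟨s, hs, rfl⟩
  exact h s hs

lemma IsDiag.apply_homPoly {T : Op n} {c : (Fin n →₀ ℕ) → ℂ} (hT : IsDiag T c) {m k : ℕ} {b : ℂ}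
    (h : ∀ s ∈ expo n m k, c s = b) {p : Poly n} (hp : p ∈ homPoly n m k) : T p = b • p :=
  eq_of_mem_homPoly (T' := b • 1) (fun s hs => by rw [hT, h s hs]; rfl) hp

lemma expo_mono {m m' k : ℕ} (h : m ≤ m') : expo n m k ⊆ expo n m' k :=
  fun _ hs => ⟨fun l hl => hs.1 l (h.trans hl), hs.2⟩

lemma homPoly_mono {m m' k : ℕ} (h : m ≤ m') : homPoly n m k ≤ homPoly n m' k :=
  Submodule.span_mono (Set.image_mono (expo_mono h))

lemma expo_add_single {m k : ℕ} {s : Fin n →₀ ℕ} {i : Fin n} (hi : i.val < m) :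
    s + Finsupp.single i 1 ∈ expo n m (k + 1) ↔ s ∈ expo n m k := by
  have h2 : ∑ l, (s + Finsupp.single i 1 : Fin n →₀ ℕ) l = ∑ l, s l + 1 := by
    simp [Finset.sum_add_distrib, Finsupp.single_apply]
  have h1 : ∀ l : Fin n, m ≤ l.val → (s + Finsupp.single i 1 : Fin n →₀ ℕ) l = s l := fun l hl => by
    have : i ≠ l := Fin.ne_of_val_ne (by omega)
    simp [this]
  constructor
  · exact fun h => ⟨fun l hl => by rw [← h1 l hl]; exact h.1 l hl, by
      have := h.2; rw [h2] at this; omega⟩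
  · exact fun h => ⟨fun l hl => by rw [h1 l hl]; exact h.1 l hl, by rw [h2, h.2]⟩

lemma degSum_of_mem_expo {m k : ℕ} {s : Fin n →₀ ℕ} (hs : s ∈ expo n m k) : degSum m s = k := by
  rw [← hs.2, degSum]
  refine Finset.sum_congr rfl fun l _ => ?_
  split_ifs with h
  · rfl
  · exact (hs.1 l (not_lt.mp h)).symm

lemma mem_homogeneousSubmodule {m k : ℕ} {p : Poly n} (hp : p ∈ homPoly n m k) :
    p ∈ MvPolynomial.homogeneousSubmodule (Fin n) ℂ k := by
  refine map_mem_of_mem_homPoly (T := 1) (fun s hs => ?_) hp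
  refine MvPolynomial.isHomogeneous_monomial _ ?_
  rw [Finsupp.degree_eq_sum, hs.2]

lemma mulX_mem {m k : ℕ} {i : Fin n} (hi : i.val < m) {p : Poly n} (hp : p ∈ homPoly n m k) :
    mulX i p ∈ homPoly n m (k + 1) :=
  map_mem_of_mem_homPoly (fun s hs => by
    rw [mulX_monomial]; exact monomial_mem_homPoly ((expo_add_single hi).mpr hs) 1) hp

lemma mulX_pow_mem {m k : ℕ} {i : Fin n} (hi : i.val < m) {p : Poly n} (hp : p ∈ homPoly n m k)
    (a : ℕ) : (mulX i ^ a) p ∈ homPoly n m (k + a) := by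
  induction a with
  | zero => exact hp
  | succ a ih => rw [pow_succ', Module.End.mul_apply]; exact mulX_mem hi ih

variable (κ : ℂ) (μ : Fin n → ℝ)

lemma opX_mem {m k : ℕ} {p : Poly n} (hp : p ∈ homPoly n m k) :
    opX κ μ m p ∈ homPoly n m (k + 1) := by
  refine map_mem_of_mem_homPoly (fun s hs => ?_) hp
  rw [opX, LinearMap.sum_apply]
  refine Submodule.sum_mem _ fun l _ => ?_
  split_ifs with hl
  · rw [Module.End.mul_apply, isDiag_opR, map_smul]
    exact Submodule.smul_mem _ _ (mulX_mem hl (monomial_mem_homPoly hs 1))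
  · exact Submodule.zero_mem _

lemma opX_pow_mem {m k : ℕ} {p : Poly n} (hp : p ∈ homPoly n m k) (a : ℕ) :
    (opX κ μ m ^ a) p ∈ homPoly n m (k + a) := by
  induction a with
  | zero => exact hp
  | succ a ih => rw [pow_succ', Module.End.mul_apply]; exact opX_mem κ μ ih

lemma opD_mem {m k : ℕ} {p : Poly n} (hp : p ∈ homPoly n m (k + 1)) :
    opD κ μ m p ∈ homPoly n m k := by
  refine map_mem_of_mem_homPoly (fun s hs => ?_) hp
  rw [opD, LinearMap.sum_apply]
  refine Submodule.sum_mem _ fun l _ => ?_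
  split_ifs with hl
  · rw [Module.End.mul_apply, isDiag_opR, map_smul]
    refine Submodule.smul_mem _ _ ?_
    rcases exponent_cases l s with h0 | ⟨s, rfl⟩
    · rw [dunkl_monomial_zero κ μ l s h0]
      exact Submodule.zero_mem _
    · rw [dunkl_monomial_add]
      exact Submodule.smul_mem _ _ (monomial_mem_homPoly ((expo_add_single hl).mp hs) 1)
  · exact Submodule.zero_mem _

lemma opD_degree_zero {m : ℕ} {p : Poly n} (hp : p ∈ homPoly n m 0) : opD κ μ m p = 0 := by
  refine eq_of_mem_homPoly (T' := 0) (fun s hs => ?_) hp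
  rw [opD, LinearMap.sum_apply, LinearMap.zero_apply]
  refine Finset.sum_eq_zero fun l _ => ?_
  split_ifs with hl
  · have h0 : s l = 0 := Finset.sum_eq_zero_iff.mp hs.2 l (Finset.mem_univ l)
    rw [Module.End.mul_apply, isDiag_opR, map_smul, dunkl_monomial_zero κ μ l s h0, smul_zero]
  · rfl

lemma opD_pow_mem {m k : ℕ} {p : Poly n} (hp : p ∈ homPoly n m k) {a : ℕ} (ha : a ≤ k) :
    (opD κ μ m ^ a) p ∈ homPoly n m (k - a) := by
  induction a with
  | zero => exact hp
  | succ a ih =>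
    rw [pow_succ', Module.End.mul_apply]
    refine opD_mem κ μ ?_
    rw [show k - (a + 1) + 1 = k - a by omega]
    exact ih (by omega)

lemma opD_pow_succ_eq_zero {m k : ℕ} {p : Poly n} (hp : p ∈ homPoly n m k) :
    (opD κ μ m ^ (k + 1)) p = 0 := by
  rw [pow_succ', Module.End.mul_apply]
  refine opD_degree_zero (m := m) κ μ ?_
  simpa using opD_pow_mem κ μ hp le_rfl

lemma reflAfter_apply {m k : ℕ} {p : Poly n} (hp : p ∈ homPoly n m k) : reflAfter n m p = p := by
  rw [(isDiag_reflAfter m).apply_homPoly (b := 1) (fun s hs => ?_) hp, one_smul]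
  refine Finset.prod_eq_one fun l _ => ?_
  split_ifs with h
  · rfl
  · rw [hs.1 l (not_lt.mp h), pow_zero]

lemma opX_apply {m k : ℕ} (hm : m ≤ n) {p : Poly n} (hp : p ∈ homPoly n m k) :
    opX κ μ m p = partFam κ μ m .Ap p := by
  rw [opX_eq κ μ m hm, Module.End.mul_apply, reflAfter_apply hp]

lemma opD_apply {m k : ℕ} (hm : m ≤ n) {p : Poly n} (hp : p ∈ homPoly n m k) :
    opD κ μ m p = partFam κ μ m .Am p := by
  rw [opD_eq κ μ m hm, Module.End.mul_apply, reflAfter_apply hp]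

lemma partFam_K_apply {m k : ℕ} (hm : m ≤ n) {p : Poly n} (hp : p ∈ homPoly n m k) :
    partFam κ μ m .K p = qpow κ ((gamSum μ m + k) / 2) • p :=
  (isDiag_partFam_K κ μ m hm).apply_homPoly (fun s hs => by rw [degSum_of_mem_expo hs]) hp

lemma partFam_P_apply {m k : ℕ} (hm : m ≤ n) {p : Poly n} (hp : p ∈ homPoly n m k) :
    partFam κ μ m .P p = (-1 : ℂ) ^ k • p :=
  (isDiag_partFam_P κ μ m hm).apply_homPoly (fun s hs => by rw [degSum_of_mem_expo hs]) hp

lemma partFam_Kinv_apply (hq : ‖Complex.exp κ‖ ≠ 1) {m k : ℕ} (hm : m ≤ n) {p : Poly n}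
    (hp : p ∈ homPoly n m k) :
    partFam κ μ m .Kinv p = qpow κ (-((gamSum μ m + k) / 2)) • p := by
  have h := LinearMap.congr_fun (isOspFamily_partFam κ hq μ m hm).Kinv_K p
  rw [Module.End.mul_apply, partFam_K_apply κ μ hm hp, map_smul] at h
  rw [qpow_neg, eq_inv_smul_iff₀ (qpow_ne_zero _ _)]
  exact h

/-! ### Monogenics are eigenfunctions of `Γ_{[m]}^q` -/

lemma sphericalGamma_monogenic (hq : ‖Complex.exp κ‖ ≠ 1) {m k : ℕ} (h1 : 1 ≤ m) (hm : m ≤ n)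
    {p : Poly n} (hp : p ∈ homPoly n m k) (h : opD κ μ m p = 0) :
    sphericalGamma κ hq μ m p = ((-1) ^ k * qnum κ (k + gamSum μ m - 1 / 2)) • p := by
  rw [opD_apply κ μ hm hp] at h
  rw [sphericalGamma_eq κ hq μ m h1 hm, Module.End.mul_apply, partFam_P_apply κ μ hm hp, map_smul,
    scasimir]
  simp only [LinearMap.add_apply, LinearMap.neg_apply, LinearMap.smul_apply, LinearMap.sub_apply,
    Module.End.mul_apply, sq, h, map_zero, neg_zero, zero_add, partFam_K_apply κ μ hm hp, map_smul,
    partFam_Kinv_apply κ μ hq hm hp, smul_smul, ← sub_smul, ← qpow_add]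
  congr 2
  rw [qnum, div_eq_inv_mul _ (qpow κ 1 - qpow κ (-1))]
  congr 3 <;> ring

end Homogeneous

/-! ### The `CK`-extension -/

section CK

variable {n : ℕ} (κ : ℂ) (μ : Fin n → ℝ)

lemma mulX_pow_monomial (i : Fin n) (a : ℕ) (s : Fin n →₀ ℕ) (c : ℂ) :
    (mulX i ^ a) (MvPolynomial.monomial s c) =
      MvPolynomial.monomial (s + Finsupp.single i a) c := by
  induction a with
  | zero => simp
  | succ a ih =>
    rw [pow_succ', Module.End.mul_apply, ih, mulX_monomial, add_assoc, ← Finsupp.single_add]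

lemma dunkl_mulX_pow {i : Fin n} {d : ℕ} {p : Poly n} (hp : p ∈ homPoly n i.val d) (a : ℕ) :
    dunkl κ μ i ((mulX i ^ a) p) = qbracket κ (μ i) a • (mulX i ^ (a - 1)) p := by
  rw [← Module.End.mul_apply, ← LinearMap.smul_apply]
  refine eq_of_mem_homPoly (fun s hs => ?_) hp
  have hs0 := hs.1 i le_rfl
  rw [Module.End.mul_apply, LinearMap.smul_apply, mulX_pow_monomial, mulX_pow_monomial]
  cases a with
  | zero =>
    rw [dunkl_monomial_zero κ μ i _ (by simp [hs0])]
    simp [qbracket]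
  | succ a =>
    rw [Finsupp.single_add, ← add_assoc, dunkl_monomial_add, Nat.add_sub_cancel]
    congr 1
    simp only [Finsupp.add_apply, hs0, Finsupp.single_eq_same, zero_add, qpow_pow, qbracket, qnum,
      neg_add, qpow_add, mul_one, mul_neg]
    ring

lemma opK_reflOp_mulX_pow {i : Fin n} {d : ℕ} {p : Poly n} (hp : p ∈ homPoly n i.val d) (a : ℕ) :
    (opK κ μ i * reflOp i) ((mulX i ^ a) p) =
      (qpow κ ((gam μ i + a) / 2) * (-1) ^ a) • (mulX i ^ a) p := by
  rw [← Module.End.mul_apply, ← LinearMap.smul_apply]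
  refine eq_of_mem_homPoly (fun s hs => ?_) hp
  have hs0 := hs.1 i le_rfl
  rw [Module.End.mul_apply, LinearMap.smul_apply, mulX_pow_monomial,
    (isDiag_opK κ μ i).mul (isDiag_reflOp i)]
  simp [hs0]

lemma partFam_succ_Am_mulX_pow (hq : ‖Complex.exp κ‖ ≠ 1) {i : Fin n} {d : ℕ} {p : Poly n}
    (hp : p ∈ homPoly n i.val d) (a : ℕ) :
    partFam κ μ (i.val + 1) .Am ((mulX i ^ a) p) =
      (qpow κ ((gam μ i + a) / 2) * (-1) ^ a) • (mulX i ^ a) (opD κ μ i.val p) +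
      (qbracket κ (μ i) a * qpow κ (-((gamSum μ i.val + d) / 2))) • (mulX i ^ (a - 1)) p := by
  have hc : ∀ g b, partFam κ μ i.val g * mulX i ^ b = mulX i ^ b * partFam κ μ i.val g :=
    fun g b => ((realGen_commute_partFam κ μ i le_rfl .Ap g).pow_left b).symm
  rw [partFam_succ]
  change (partFam κ μ i.val .Am * (opK κ μ i * reflOp i) +
    partFam κ μ i.val .Kinv * dunkl κ μ i) ((mulX i ^ a) p) = _
  rw [LinearMap.add_apply, Module.End.mul_apply, Module.End.mul_apply _ (dunkl κ μ i),
    opK_reflOp_mulX_pow κ μ hp, dunkl_mulX_pow κ μ hp, map_smul, map_smul, ← Module.End.mul_apply,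
    hc, ← Module.End.mul_apply, hc, Module.End.mul_apply, Module.End.mul_apply,
    partFam_Kinv_apply κ μ hq i.isLt.le hp, opD_apply κ μ i.isLt.le hp, map_smul, smul_smul]

/-- The coefficients of the `CK`-extension. -/
def ckCoeff (i : Fin n) (k α : ℕ) : ℂ :=
  (-1) ^ (α * (α + 1) / 2) *
    qpow κ ((α : ℝ) / 2 * (gamSum μ (i.val + 1) + (k : ℝ) - 1)) /
      ∏ s ∈ Finset.Icc 1 α, qbracket κ (μ i) s

lemma CK_apply (i : Fin n) (k : ℕ) (p : Poly n) :
    CK κ μ i k p = ∑ α ∈ Finset.range (k + 1),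
      ckCoeff κ μ i k α • (mulX i ^ α) ((opD κ μ i.val ^ α) p) := by
  rw [CK, LinearMap.sum_apply]
  rfl

lemma ckCoeff_succ (hq : ‖Complex.exp κ‖ ≠ 1) (hμ : ∀ i, 0 < μ i) (i : Fin n) {k α : ℕ}
    (hα : α + 1 ≤ k) :
    ckCoeff κ μ i k (α + 1) * (qbracket κ (μ i) (α + 1) *
      qpow κ (-((gamSum μ i.val + (k - (α + 1) : ℕ)) / 2))) =
    -(ckCoeff κ μ i k α * (qpow κ ((gam μ i + α) / 2) * (-1) ^ α)) := by
  have hb : qbracket κ (μ i) (α + 1) ≠ 0 := qbracket_ne_zero hq (hμ i) (by omega)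
  have hb' : ∏ s ∈ Finset.Icc 1 α, qbracket κ (μ i) s ≠ 0 :=
    Finset.prod_ne_zero_iff.mpr fun s hs =>
      qbracket_ne_zero hq (hμ i) (Finset.mem_Icc.mp hs).1
  have h1 : (α + 1) * (α + 1 + 1) / 2 = α * (α + 1) / 2 + (α + 1) := by
    rw [show (α + 1) * (α + 1 + 1) = α * (α + 1) + (α + 1) * 2 by ring,
      Nat.add_mul_div_right _ _ (by norm_num)]
  have h2 : qpow κ (((α + 1 : ℕ) : ℝ) / 2 * (gamSum μ (i.val + 1) + (k : ℝ) - 1)) *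
      qpow κ (-((gamSum μ i.val + (k - (α + 1) : ℕ)) / 2)) =
      qpow κ ((α : ℝ) / 2 * (gamSum μ (i.val + 1) + (k : ℝ) - 1)) *
        qpow κ ((gam μ i + α) / 2) := by
    rw [← qpow_add, ← qpow_add, gamSum_succ, Nat.cast_sub hα]
    congr 1
    push_cast
    ring
  rw [ckCoeff, ckCoeff, Finset.prod_Icc_succ_top (by omega), h1, pow_add, pow_succ _ α]
  generalize qpow κ (((α + 1 : ℕ) : ℝ) / 2 * (gamSum μ (i.val + 1) + (k : ℝ) - 1)) = x at *
  generalize qpow κ (-((gamSum μ i.val + (k - (α + 1) : ℕ)) / 2)) = y at *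
  generalize qpow κ ((α : ℝ) / 2 * (gamSum μ (i.val + 1) + (k : ℝ) - 1)) = z at *
  generalize qpow κ ((gam μ i + α) / 2) = w at *
  field_simp
  linear_combination (-1 : ℂ) * h2

lemma CK_mem {i : Fin n} {k : ℕ} {p : Poly n} (hp : p ∈ homPoly n i.val k) :
    CK κ μ i k p ∈ homPoly n (i.val + 1) k := by
  rw [CK_apply]
  refine Submodule.sum_mem _ fun α hα => Submodule.smul_mem _ _ ?_
  have hα' : α ≤ k := by simpa [Nat.lt_succ_iff] using hα
  have h := mulX_pow_mem (Nat.lt_succ_self i.val)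
    (homPoly_mono (Nat.le_succ _) (opD_pow_mem κ μ hp hα')) α
  rwa [Nat.sub_add_cancel hα'] at h

lemma partFam_Am_CK_partial (hq : ‖Complex.exp κ‖ ≠ 1) (hμ : ∀ i, 0 < μ i) {i : Fin n} {k : ℕ}
    {p : Poly n} (hp : p ∈ homPoly n i.val k) (N : ℕ) (hN : N ≤ k) :
    partFam κ μ (i.val + 1) .Am (∑ α ∈ Finset.range (N + 1),
      ckCoeff κ μ i k α • (mulX i ^ α) ((opD κ μ i.val ^ α) p)) =
    (ckCoeff κ μ i k N * (qpow κ ((gam μ i + N) / 2) * (-1) ^ N)) •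
      (mulX i ^ N) ((opD κ μ i.val ^ (N + 1)) p) := by
  induction N with
  | zero =>
    rw [zero_add, Finset.sum_range_one, map_smul,
      partFam_succ_Am_mulX_pow κ μ hq (opD_pow_mem κ μ hp (Nat.zero_le k))]
    simp [qbracket, smul_smul]
  | succ N ih =>
    rw [Finset.sum_range_succ, map_add, ih (by omega), map_smul,
      partFam_succ_Am_mulX_pow κ μ hq (opD_pow_mem κ μ hp hN), smul_add, smul_smul, smul_smul,
      ckCoeff_succ κ μ hq hμ i hN, Nat.add_sub_cancel, neg_smul, pow_succ' _ (N + 1),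
      Module.End.mul_apply (opD κ μ i.val)]
    abel

lemma opD_CK (hq : ‖Complex.exp κ‖ ≠ 1) (hμ : ∀ i, 0 < μ i) {i : Fin n} {k : ℕ}
    {p : Poly n} (hp : p ∈ homPoly n i.val k) : opD κ μ (i.val + 1) (CK κ μ i k p) = 0 := by
  rw [opD_apply κ μ i.isLt (CK_mem κ μ hp), CK_apply,
    partFam_Am_CK_partial κ μ hq hμ hp k le_rfl, opD_pow_succ_eq_zero κ μ hp, map_zero, smul_zero]

lemma dilate_zero_mulX_pow {i : Fin n} {d : ℕ} {p : Poly n} (hp : p ∈ homPoly n i.val d) (a : ℕ) :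
    dilate i 0 ((mulX i ^ a) p) = (0 : ℂ) ^ a • (mulX i ^ a) p := by
  refine eq_of_mem_homPoly (T := dilate i 0 * mulX i ^ a) (T' := (0 : ℂ) ^ a • mulX i ^ a)
    (fun s hs => ?_) hp
  rw [Module.End.mul_apply, LinearMap.smul_apply, mulX_pow_monomial, dilate_monomial]
  simp [hs.1 i le_rfl]

lemma dilate_zero_CK {i : Fin n} {k : ℕ} {p : Poly n} (hp : p ∈ homPoly n i.val k) :
    dilate i 0 (CK κ μ i k p) = p := by
  rw [CK_apply, map_sum, Finset.sum_eq_single_of_mem 0 (by simp)]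
  · rw [map_smul, dilate_zero_mulX_pow (opD_pow_mem κ μ hp (Nat.zero_le k))]
    simp [ckCoeff, qpow_zero]
  · intro α hα h0
    rw [map_smul, dilate_zero_mulX_pow (opD_pow_mem κ μ hp (by simpa [Nat.lt_succ_iff] using hα)),
      zero_pow h0, zero_smul, smul_zero]

lemma CK_ne_zero {i : Fin n} {k : ℕ} {p : Poly n} (hp : p ∈ homPoly n i.val k) (h : p ≠ 0) :
    CK κ μ i k p ≠ 0 := fun h0 => h (by rw [← dilate_zero_CK κ μ hp, h0, map_zero])

end CK

/-! ### Injectivity of `X_{[m]}^q` -/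

section Injectivity

variable {n : ℕ} (κ : ℂ) (μ : Fin n → ℝ)

lemma coeff_eq_zero_of_commute_opK (hq : ‖Complex.exp κ‖ ≠ 1) {i : Fin n} {Z : Op n}
    (hZ : Commute (opK κ μ i) Z) {s u : Fin n →₀ ℕ} (h : s i ≠ u i) (a : ℂ) :
    (Z (MvPolynomial.monomial s a)).coeff u = 0 := by
  have h1 := (isDiag_opK κ μ i).coeff u (Z (MvPolynomial.monomial s a))
  rw [← Module.End.mul_apply, hZ.eq, Module.End.mul_apply, isDiag_opK κ μ i s a, map_smul,
    MvPolynomial.coeff_smul, smul_eq_mul, ← sub_eq_zero, ← sub_mul] at h1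
  refine (mul_eq_zero.mp h1).resolve_left fun h2 => h ?_
  have h3 := qpow_injective hq (sub_eq_zero.mp h2)
  exact_mod_cast (show (s i : ℝ) = u i by linarith)

lemma partFam_succ_Ap_ne_zero (hq : ‖Complex.exp κ‖ ≠ 1) (i : Fin n) {p : Poly n} (hp : p ≠ 0) :
    partFam κ μ (i.val + 1) .Ap p ≠ 0 := by
  intro h
  obtain ⟨s, hs, hmax⟩ := Finset.exists_max_image p.support (fun s => s i)
    (MvPolynomial.support_nonempty.mpr hp)
  have hF := isOspFamily_partFam κ hq μ i.val i.isLt.le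
  set Z : Op n := partFam κ μ i.val .K * partFam κ μ i.val .Ap * (opK κ μ i * reflOp i) with hZ
  have h1 : Z p + mulX i p = 0 := by
    have h2 : partFam κ μ i.val .K * partFam κ μ (i.val + 1) .Ap = Z + mulX i := by
      rw [partFam_succ]
      change _ * (_ * (opK κ μ i * reflOp i) + _ * mulX i) = _
      rw [mul_add, ← mul_assoc, ← mul_assoc _ _ (mulX i), hF.K_Kinv, one_mul]
    rw [← LinearMap.add_apply, ← h2, Module.End.mul_apply, h, map_zero]
  have hcomm : Commute (opK κ μ i) Z :=
    ((realGen_commute_partFam κ μ i le_rfl .K .K).mul_right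
      (realGen_commute_partFam κ μ i le_rfl .K .Ap)).mul_right
      ((Commute.refl _).mul_right ((dilate_commute_dilate _ _ _ _).smul_left _))
  have h3 : (Z p).coeff (s + Finsupp.single i 1) = 0 := by
    rw [p.as_sum, map_sum, MvPolynomial.coeff_sum]
    refine Finset.sum_eq_zero fun t ht => coeff_eq_zero_of_commute_opK κ μ hq hcomm ?_ _
    have := hmax t ht
    simp
    omega
  have h4 : (mulX i p).coeff (s + Finsupp.single i 1) = p.coeff s := by
    rw [add_comm]
    exact MvPolynomial.coeff_X_mul _ _ _
  have h5 := congrArg (MvPolynomial.coeff (s + Finsupp.single i 1)) h1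
  rw [MvPolynomial.coeff_add, h3, h4, zero_add, MvPolynomial.coeff_zero] at h5
  exact MvPolynomial.mem_support_iff.mp hs h5

lemma opX_pow_ne_zero (hq : ‖Complex.exp κ‖ ≠ 1) (i : Fin n) {k : ℕ} {p : Poly n}
    (hp : p ∈ homPoly n (i.val + 1) k) (h0 : p ≠ 0) (a : ℕ) :
    (opX κ μ (i.val + 1) ^ a) p ≠ 0 := by
  induction a with
  | zero => exact h0
  | succ a ih =>
    rw [pow_succ', Module.End.mul_apply, opX_apply κ μ i.isLt (opX_pow_mem κ μ hp a)]
    exact partFam_succ_Ap_ne_zero κ μ hq i ih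

end Injectivity

/-! ### The tower of `CK`-extensions -/

section Tower

variable {n : ℕ} (κ : ℂ) (μ : Fin n → ℝ) (j : Fin (n - 1) → ℕ)

lemma partialSum_succ (i : Fin (n - 1)) :
    partialSum j (i.val + 1) = partialSum j i.val + j i := sum_lt_succ _ i

lemma X_pow_mem (i : Fin n) (a : ℕ) :
    (MvPolynomial.X i ^ a : Poly n) ∈ homPoly n (i.val + 1) a := by
  rw [MvPolynomial.X_pow_eq_monomial]
  refine monomial_mem_homPoly ⟨fun l hl => ?_, ?_⟩ 1
  · exact Finsupp.single_eq_of_ne (Fin.ne_of_val_ne (by omega))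
  · simp [Finsupp.single_apply]

lemma mulX_pow_one (i : Fin n) (a : ℕ) : (mulX i ^ a) (1 : Poly n) = MvPolynomial.X i ^ a := by
  change (mulX i ^ a) (MvPolynomial.monomial 0 1) = _
  rw [mulX_pow_monomial, MvPolynomial.X_pow_eq_monomial, zero_add]

lemma sphericalGamma_one_X_pow (hq : ‖Complex.exp κ‖ ≠ 1) (h : 0 < n) (a : ℕ) :
    sphericalGamma κ hq μ 1 (MvPolynomial.X ⟨0, h⟩ ^ a) =
      eigval κ μ j 1 • (MvPolynomial.X ⟨0, h⟩ ^ a : Poly n) := by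
  let i : Fin n := ⟨0, h⟩
  have hX : partFam κ μ 1 .Ap = mulX i := by
    change partFam κ μ (i.val + 1) .Ap = _
    rw [partFam_succ]
    simp [comb, partFam, i, realGen]
  have h1 : (1 : Poly n) ∈ homPoly n 1 0 := by simpa using X_pow_mem i 0
  have hc := (sphericalGamma_commute_partFam κ hq μ 1 1 le_rfl le_rfl h .Ap).pow_right a
  rw [hX] at hc
  change sphericalGamma κ hq μ 1 (MvPolynomial.X i ^ a) = _ • MvPolynomial.X i ^ a
  rw [← mulX_pow_one, ← Module.End.mul_apply, hc.eq, Module.End.mul_apply,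
    sphericalGamma_monogenic κ μ hq le_rfl h h1 (opD_degree_zero κ μ h1), map_smul]
  simp [eigval, partialSum]

lemma apply_eq_smul_of_commute {S T : Op n} (h : Commute S T) {p : Poly n} {c : ℂ}
    (hp : S p = c • p) : S (T p) = c • T p := by
  rw [← Module.End.mul_apply, h.eq, Module.End.mul_apply, hp, map_smul]

lemma sphericalGamma_CK (hq : ‖Complex.exp κ‖ ≠ 1) (hμ : ∀ i, 0 < μ i) {i : Fin n} {p : Poly n}
    (hp : p ∈ homPoly n i.val (partialSum j i.val))
    (h : ∀ ℓ, 1 ≤ ℓ → ℓ ≤ i.val → sphericalGamma κ hq μ ℓ p = eigval κ μ j ℓ • p) {ℓ : ℕ}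
    (h1 : 1 ≤ ℓ) (hℓ : ℓ ≤ i.val + 1) :
    sphericalGamma κ hq μ ℓ (CK κ μ i (partialSum j i.val) p) =
      eigval κ μ j ℓ • CK κ μ i (partialSum j i.val) p := by
  rcases hℓ.lt_or_eq with hlt | rfl
  · have hle := Nat.lt_succ_iff.mp hlt
    exact apply_eq_smul_of_commute (sphericalGamma_commute_CK κ μ hq ℓ h1 i hle _) (h ℓ h1 hle)
  · exact sphericalGamma_monogenic κ μ hq h1 i.isLt (CK_mem κ μ hp) (opD_CK κ μ hq hμ hp)

/-- A non-zero homogeneous polynomial of degree `k` in the first `m` variables that lies in the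
kernel of `D_{[m]}^q` and has the eigenvalues `λ_ℓ(𝐣)` for `1 ≤ ℓ ≤ m`. -/
structure IsJointEigenfunction (hq : ‖Complex.exp κ‖ ≠ 1) (m k : ℕ) (p : Poly n) : Prop where
  mem : p ∈ homPoly n m k
  ne_zero : p ≠ 0
  opD_eq_zero : opD κ μ m p = 0
  eig : ∀ ℓ, 1 ≤ ℓ → ℓ ≤ m → sphericalGamma κ hq μ ℓ p = eigval κ μ j ℓ • p

lemma isJointEigenfunction_CK (hq : ‖Complex.exp κ‖ ≠ 1) (hμ : ∀ i, 0 < μ i) {i : Fin n}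
    {p : Poly n} (hp : p ∈ homPoly n i.val (partialSum j i.val)) (h0 : p ≠ 0)
    (h : ∀ ℓ, 1 ≤ ℓ → ℓ ≤ i.val → sphericalGamma κ hq μ ℓ p = eigval κ μ j ℓ • p) :
    IsJointEigenfunction κ μ j hq (i.val + 1) (partialSum j i.val)
      (CK κ μ i (partialSum j i.val) p) :=
  ⟨CK_mem κ μ hp, CK_ne_zero κ μ hp h0, opD_CK κ μ hq hμ hp,
    fun _ h1 hℓ => sphericalGamma_CK κ μ j hq hμ hp h h1 hℓ⟩

theorem isJointEigenfunction_tower (hq : ‖Complex.exp κ‖ ≠ 1) (hμ : ∀ i, 0 < μ i) (m : ℕ)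
    (hm : m + 2 ≤ n) :
    IsJointEigenfunction κ μ j hq (m + 2) (partialSum j (m + 1)) (tower κ μ j m hm) := by
  induction m with
  | zero =>
    rw [tower]
    have hs : partialSum j 1 = j ⟨0, by omega⟩ := by
      have := partialSum_succ j ⟨0, by omega⟩
      simpa [partialSum] using this
    refine isJointEigenfunction_CK κ μ j hq hμ (i := ⟨1, hm⟩) ?_
      (pow_ne_zero _ (MvPolynomial.X_ne_zero _)) fun ℓ h1 hℓ => ?_
    · simp only [hs]
      exact X_pow_mem ⟨0, by omega⟩ _
    · obtain rfl : ℓ = 1 := le_antisymm hℓ h1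
      exact sphericalGamma_one_X_pow κ μ j hq (by omega) _
  | succ m ih =>
    have h := ih (by omega)
    rw [tower]
    refine isJointEigenfunction_CK κ μ j hq hμ (i := ⟨m + 2, hm⟩) ?_
      (opX_pow_ne_zero κ μ hq ⟨m + 1, by omega⟩ h.mem h.ne_zero _) fun ℓ h1 hℓ => ?_
    · have hs := partialSum_succ j ⟨m + 1, by omega⟩
      simp only at hs ⊢
      rw [hs]
      exact opX_pow_mem κ μ h.mem _
    · exact apply_eq_smul_of_commute
        ((sphericalGamma_commute_opX κ μ hq ℓ (m + 2) h1 hℓ (by omega)).pow_right _) (h.eig ℓ h1 hℓ)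

end Tower

end

end QDiracDunkl

theorem proposition4p3 (n : ℕ) (hn : 2 ≤ n) (κ : ℂ) (hq : ‖Complex.exp κ‖ ≠ 1)
    (μ : Fin n → ℝ) (hμ : ∀ i, 0 < μ i) (k : ℕ) (j : Fin (n - 1) → ℕ) (hj : ∑ i, j i = k) :
    QDiracDunkl.psi hn κ μ j ∈ QDiracDunkl.monogenics κ μ k ∧
    QDiracDunkl.psi hn κ μ j ≠ 0 ∧
    ∀ ℓ : ℕ, 1 ≤ ℓ → ℓ ≤ n →
      QDiracDunkl.sphericalGamma κ hq μ ℓ (QDiracDunkl.psi hn κ μ j) =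
        QDiracDunkl.eigval κ μ j ℓ • QDiracDunkl.psi hn κ μ j := by
  obtain ⟨hmem, hne, hD, heig⟩ := QDiracDunkl.isJointEigenfunction_tower κ μ j hq hμ (n - 2) (by omega)
  have hsum : QDiracDunkl.partialSum j (n - 2 + 1) = k := by
    rw [← hj, QDiracDunkl.partialSum]
    exact Finset.sum_congr rfl fun l _ => if_pos (by omega)
  rw [hsum] at hmem
  refine ⟨⟨?_, QDiracDunkl.mem_homogeneousSubmodule hmem⟩, hne, fun ℓ h1 hℓ =>
    heig ℓ h1 (by omega)⟩
  have h2 : QDiracDunkl.opD κ μ n = QDiracDunkl.opD κ μ (n - 2 + 2) := by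
    rw [Nat.sub_add_cancel hn]
  exact LinearMap.mem_ker.mpr (by rw [h2]; exact hD)
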